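/- Let $F$ be a (finite-dimensional real) Lie group with a filtration $\mathcal V$ by closed subgroups $F=F_0\ge F_1\ge\dots\ge F_k=\{1\}$, $[F,F_i]\le F_{i+1}$ for $0\le i<k$ (so $F$ is nilpotent), and let $\Gamma\le F$ be a discrete subgroup such that $F_i/(F_i\cap\Gamma)$ is compact for every $0\le i\le k$. Let $M=F/\Gamma$ be the space of left cosets and $\pi:F\to M$, $\pi(g)=g\Gamma$. For $n\ge 0$, let $C^n(F)$ be the set of maps $\{0,1\}^n\to F$ obtained from the constant map $1$ in finitely many steps, where each step chooses some $i\ge 0$ and $x\in F_i$ and multiplies the values on a face of $\{0,1\}^n$ of codimension at most $i+1$ by $x$. Let $C^n(M)=\{\pi\circ c : c\in C^n(F)\}$. The $n$-cubes of the abelian group $\mathbb R/\mathbb Z$ are the maps $\{0,1\}^n\to\mathbb R/\mathbb Z$ that extend to an affine homomorphism $\mathbb Z^n\to\mathbb R/\mathbb Z$. A map $\varphi:\mathbb R/\mathbb Z\to M$ is a nilspace morphism if for every $n$ and every $n$-cube $c$ of $\mathbb R/\mathbb Z$ one has $\varphi\circ c\in C^n(M)$. A one-parameter subgroup of $F$ is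 a continuous homomorphism $f:\mathbb R\to F$. 1. For every continuous nilspace morphism $\varphi:\mathbb R/\mathbb Z\to M$ with $\varphi(0)=\pi(1)$ there is a one-parameter subgroup $f:\mathbb R\to F$ such that $f(1)\in\Gamma$ and $\varphi(x+\mathbb Z)=f(x)\Gamma$ for all $x\in\mathbb R$; moreover $f$ is unique. 2. Conversely, for every one-parameter subgroup $f:\mathbb R\to F$ with $f(1)\in\Gamma$ there is exactly one continuous nilspace morphism $\varphi:\mathbb R/\mathbb Z\to M$ with $\varphi(0)=\pi(1)$ and $\varphi(x+\mathbb Z)=f(x)\Gamma$ for all $x\in\mathbb R$. 3. If moreover $F$ is connected and simply connected, then $\varphi\mapsto f(1)$, with $f$ as in 1, is a bijection from the set of continuous nilspace morphisms $\varphi:\mathbb R/\mathbb Z\to M$ with $\varphi(0)=\pi(1)$ onto $\Gamma$. -/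

import Mathlib

open scoped Manifold ContDiff

/-- The vertex set `{0,1}^n` of the abstract cube of dimension `n`. -/
abbrev DiscreteCube (n : ℕ) : Type := Fin n → Fin 2

/-- A candidate cubic structure on `N`: a set `C^n(N)` of maps `{0,1}^n → N` for every `n`. -/
abbrev CubeFamily (N : Type*) : Type _ := (n : ℕ) → Set (DiscreteCube n → N)

/-- Morphisms of cubic structures: composition with `φ` takes cubes to cubes, in every dimension. -/
def IsCubeMorphism {X Y : Type*} (CX : CubeFamily X) (CY : CubeFamily Y) (φ : X → Y) : Prop :=
  ∀ n : ℕ, ∀ c ∈ CX n, φ ∘ c ∈ CY n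

/-- The cubes of an abelian group `A`: the maps `{0,1}^n → A` which extend to an affine
homomorphism `ℤ^n → A`. -/
def abelianCubes (A : Type*) [AddCommGroup A] : CubeFamily A := fun n =>
  {c | ∃ (a : A) (L : (Fin n → ℤ) →+ A), ∀ v, c v = a + L (fun i => ((v i : ℕ) : ℤ))}

/-- A filtration `F = F_0 ≥ F_1 ≥ ⋯ ≥ F_k = {1}` of a group with `[F, F_i] ≤ F_{i+1}` for `i < k`.
(The groups `F_i` with `i > k` are trivial by monotonicity.) -/
structure GroupFiltration (F : Type*) [Group F] (k : ℕ) where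
  grp : ℕ → Subgroup F
  antitone : Antitone grp
  grp_zero : grp 0 = ⊤
  grp_last : grp k = ⊥
  commutator_le : ∀ i < k, ⁅(⊤ : Subgroup F), grp i⁆ ≤ grp (i + 1)

/-- The face of `{0,1}^n` on which the coordinates in `J` agree with those of `w`.
Its codimension is the cardinality of `J`. -/
def cubeFace {n : ℕ} (J : Finset (Fin n)) (w : DiscreteCube n) : Set (DiscreteCube n) :=
  {v | ∀ j ∈ J, v j = w j}

/-- The maps `{0,1}^n → F` obtained from the constant map `1` in finitely many steps, where in each
step the values on a face of codimension `i + 1` are multiplied by an element of `F_i`.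
(A face of codimension at most `i` is a disjoint union of faces of codimension `i + 1`, if the
dimension of the cube permits; allowing `J.card ≤ i + 1` makes all maps from the one-point cube
`{0,1}^0` cubes, and adds nothing for `n ≥ 1`.) -/
def cubeGroup {F : Type*} [Group F] {k : ℕ} (V : GroupFiltration F k) (n : ℕ) :
    Subgroup (DiscreteCube n → F) :=
  Subgroup.closure
    {c | ∃ (i : ℕ) (J : Finset (Fin n)) (w : DiscreteCube n) (x : F),
      J.card ≤ i + 1 ∧ x ∈ V.grp i ∧ c = (cubeFace J w).mulIndicator (fun _ => x)}

/-- The cubes of the left coset space `F / Γ`: the projections of the cubes of `F`. -/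
def cosetCubes {F : Type*} [Group F] {k : ℕ} (V : GroupFiltration F k) (Γ : Subgroup F) :
    CubeFamily (F ⧸ Γ) := fun n =>
  {c | ∃ b ∈ cubeGroup V n, c = fun v => (QuotientGroup.mk (b v) : F ⧸ Γ)}

/-- `Γ` is co-compact in the filtration: `F_i / (F_i ∩ Γ)` is compact for every `0 ≤ i ≤ k`. -/
def CocompactIn {F : Type*} [Group F] [TopologicalSpace F] {k : ℕ}
    (Γ : Subgroup F) (V : GroupFiltration F k) : Prop :=
  ∀ i ≤ k, CompactSpace (V.grp i ⧸ Γ.subgroupOf (V.grp i))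

/-- The continuous morphisms `φ : ℝ/ℤ → F / Γ` with `φ(0) = Γ`. -/
def circleMorphisms {F : Type*} [Group F] [TopologicalSpace F] {k : ℕ}
    (V : GroupFiltration F k) (Γ : Subgroup F) : Set (UnitAddCircle → F ⧸ Γ) :=
  {φ | Continuous φ ∧ IsCubeMorphism (abelianCubes UnitAddCircle) (cosetCubes V Γ) φ ∧
    φ 0 = QuotientGroup.mk 1}

/-- One-parameter subgroups of `F`: continuous homomorphisms `ℝ → F`. -/
abbrev OneParameterSubgroup (F : Type*) [Group F] [TopologicalSpace F] : Type _ :=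
  Multiplicative ℝ →ₜ* F

/-- The map `φ : ℝ/ℤ → F / Γ` is induced by `f`, i.e. `φ(x + ℤ) = f(x)Γ` for all real `x`. -/
def IsInducedBy {F : Type*} [Group F] [TopologicalSpace F] {Γ : Subgroup F}
    (φ : UnitAddCircle → F ⧸ Γ) (f : OneParameterSubgroup F) : Prop :=
  ∀ x : ℝ, φ (x : UnitAddCircle) = QuotientGroup.mk (f (Multiplicative.ofAdd x))

/-! Part 1 is a rigidity statement. The composite of ℝ → ℝ/ℤ with φ lifts through the covering F →
F/Γ to a continuous g with g(0) = 1, and discreteness of Γ forces g(x + 1) = g(x) g(1). That g is a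
homomorphism is proved modulo F_i by induction on i. In each step (`map_add_of_cubes`) g is
considered in F/F_{i+1}, where it is already a homomorphism up to the central subgroup A =
F_i/F_{i+1}. On an affine cube, g agrees with one cube of the group modulo A and with another modulo
Γ; combining the two puts all high iterated differences of g into the image of Γ. That image is
discrete because of cocompactness (`discreteTopology_map_mk'`), so shrinking the steps to 0 makes
the differences trivial: g is polynomial. Its defect (g x g y)⁻¹ g(x + y) is then a central cocycle,
polynomial and 1-periodic in x. The leading coefficient of such a cocycle is biadditive and trivial
at 1, hence trivial, so the degree drops until the defect is constant in x
(`periodic_cocycle_const`), and it is 1 at x = 0.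

Part 2 holds because a homomorphism turns a real affine cube into a product of one constant and one
face step per coordinate direction.

Part 3 reduces to the bijectivity of f ↦ f(1) from one-parameter subgroups to F. A local exponential
map is obtained from square roots in a chart and binary expansions of the time parameter. Rigidity
(`eq_of_apply_one_eq`): continuous families of one-parameter subgroups with equal values at 1
coincide once they coincide at one point of a connected parameter space. Lifting
(`LocalExp.exists_lift`): paths in F lift to paths of one-parameter subgroups, by induction along
the upper central series. Lifting a path from 1 to x gives surjectivity; lifting a homotopy between
two one-parameter subgroups gives injectivity. -/

section

open scoped commutatorElement Topology

/-! ### Proper filtrations and their cubes -/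

/-- A filtration of a group by subgroups `P_0 ≥ P_1 ≥ ⋯` with `[P_a, P_b] ≤ P_{a+b}`. -/
structure ProperFiltration (G : Type*) [Group G] where
  grp : ℕ → Subgroup G
  antitone : Antitone grp
  commutator_mem : ∀ {a b : ℕ} {x y : G}, x ∈ grp a → y ∈ grp b → ⁅x, y⁆ ∈ grp (a + b)

namespace ProperFiltration

variable {G : Type*} [Group G] (P : ProperFiltration G)

theorem mem_of_le {a b : ℕ} (h : a ≤ b) {x : G} (hx : x ∈ P.grp b) : x ∈ P.grp a :=
  P.antitone h hx

theorem conj_mem {a : ℕ} {x y : G} (hx : x ∈ P.grp a) (hy : y ∈ P.grp 0) :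
    y * x * y⁻¹ ∈ P.grp a := by
  have h := P.commutator_mem hy hx
  rw [zero_add] at h
  have h2 := mul_mem h hx
  rwa [commutatorElement_def, inv_mul_cancel_right] at h2

/-- The filtration of the group of pairs `(x, y)` with `x ∈ P_a` and `x⁻¹ * y ∈ P_{a+1}`. -/
def pair : ProperFiltration (G × G) where
  grp a :=
    { carrier := {p | p.1 ∈ P.grp a ∧ p.1⁻¹ * p.2 ∈ P.grp (a + 1)}
      one_mem' := by simp [one_mem]
      mul_mem' := by
        rintro ⟨x, y⟩ ⟨z, w⟩ ⟨hx, hy⟩ ⟨hz, hw⟩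
        refine ⟨mul_mem hx hz, ?_⟩
        have h1 := P.conj_mem hy (y := z⁻¹) (inv_mem (P.mem_of_le (Nat.zero_le a) hz))
        have h2 := mul_mem h1 hw
        simp only [Prod.mk_mul_mk] at h2 ⊢
        convert h2 using 1
        group
      inv_mem' := by
        rintro ⟨x, y⟩ ⟨hx, hy⟩
        refine ⟨inv_mem hx, ?_⟩
        have h1 := P.conj_mem (inv_mem hy) (P.mem_of_le (Nat.zero_le a) hx)
        simp only [Prod.inv_mk] at h1 ⊢
        convert h1 using 1
        group }
  antitone a b hab := by
    rintro ⟨x, y⟩ ⟨hx, hy⟩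
    exact ⟨P.mem_of_le hab hx, P.mem_of_le (Nat.succ_le_succ hab) hy⟩
  commutator_mem := by
    rintro a b ⟨x, y⟩ ⟨z, w⟩ ⟨hx, hy⟩ ⟨hz, hw⟩
    refine ⟨P.commutator_mem hx hz, ?_⟩
    simp only at hx hy hz hw
    obtain ⟨c, rfl⟩ : ∃ c, y = x * c := ⟨x⁻¹ * y, by group⟩
    obtain ⟨d, rfl⟩ : ∃ d, w = z * d := ⟨z⁻¹ * w, by group⟩
    rw [inv_mul_cancel_left] at hy hw
    have hx0 := P.mem_of_le (Nat.zero_le _) hx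
    have hz0 := P.mem_of_le (Nat.zero_le _) hz
    have hzd : z * d ∈ P.grp b := mul_mem hz (P.mem_of_le (Nat.le_succ b) hw)
    -- With y = xc and w = zd, the quotient [x,z]⁻¹ [xc,zd] is a product of conjugates of [c,zd] and
    -- [x,d], each of which has gained one degree from c or d.
    have h1 : x * ⁅c, z * d⁆ * x⁻¹ ∈ P.grp (a + b + 1) :=
      P.conj_mem (P.mem_of_le (by omega) (P.commutator_mem hy hzd)) hx0
    have h2 : z * ⁅x, d⁆ * z⁻¹ ∈ P.grp (a + b + 1) :=
      P.conj_mem (P.mem_of_le (by omega) (P.commutator_mem hx hw)) hz0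
    have h3 := mul_mem (P.conj_mem h1
      (inv_mem (P.mem_of_le (Nat.zero_le _) (P.commutator_mem hx hz)))) h2
    simp only [commutatorElement_def, Prod.mk_mul_mk, Prod.inv_mk] at h3 ⊢
    convert h3 using 1
    group

/-- The preimage of a filtration under a homomorphism. -/
def comap {H : Type*} [Group H] (f : H →* G) : ProperFiltration H where
  grp a := (P.grp a).comap f
  antitone _ _ hab := Subgroup.comap_mono (P.antitone hab)
  commutator_mem hx hy := by
    rw [Subgroup.mem_comap, map_commutatorElement]
    exact P.commutator_mem hx hy

end ProperFiltration

/-- The two faces of a map on the `(n+1)`-cube on which the first coordinate is constant. -/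
def cubeFaces (G : Type*) [Group G] (n : ℕ) :
    (DiscreteCube (n + 1) → G) →* (DiscreteCube n → G) × (DiscreteCube n → G) where
  toFun c := (fun v => c (Fin.cons 0 v), fun v => c (Fin.cons 1 v))
  map_one' := rfl
  map_mul' _ _ := rfl

/-- The difference of the two faces of a map on the `(n+1)`-cube in the first direction. -/
def cubeDiff {G : Type*} [Group G] {n : ℕ} (c : DiscreteCube (n + 1) → G) : DiscreteCube n → G :=
  fun v => (c (Fin.cons 0 v))⁻¹ * c (Fin.cons 1 v)

/-- The iterated difference (a noncommutative alternating product) of a map on a cube. -/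
def cubeAlt {G : Type*} [Group G] : (n : ℕ) → (DiscreteCube n → G) → G
  | 0, c => c default
  | n + 1, c => cubeAlt n (cubeDiff c)

namespace ProperFiltration

variable {G : Type*} [Group G] (P : ProperFiltration G)

/-- The cubes of a filtered group, as a filtration of the group of maps on the discrete cube. -/
def cubes : (n : ℕ) → ProperFiltration (DiscreteCube n → G)
  | 0 => P.comap (Pi.evalMonoidHom (fun _ : DiscreteCube 0 => G) default)
  | n + 1 => (cubes n).pair.comap (cubeFaces G n)

theorem mem_cubes_zero {a : ℕ} {c : DiscreteCube 0 → G} :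
    c ∈ (P.cubes 0).grp a ↔ c default ∈ P.grp a := Iff.rfl

theorem mem_cubes_succ {n a : ℕ} {c : DiscreteCube (n + 1) → G} :
    c ∈ (P.cubes (n + 1)).grp a ↔
      (fun v => c (Fin.cons 0 v)) ∈ (P.cubes n).grp a ∧ cubeDiff c ∈ (P.cubes n).grp (a + 1) :=
  Iff.rfl

/-- Each difference raises the degree by one. Hence the alternating product is trivial on cubes
whose dimension reaches the length of the filtration. -/
theorem cubeAlt_mem {n a : ℕ} {c : DiscreteCube n → G} (hc : c ∈ (P.cubes n).grp a) :
    cubeAlt n c ∈ P.grp (a + n) := by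
  induction n generalizing a with
  | zero => exact hc
  | succ n ih =>
    have := ih ((P.mem_cubes_succ).1 hc).2
    rwa [add_right_comm] at this

theorem const_mem_cubes (n : ℕ) {a : ℕ} {x : G} (hx : x ∈ P.grp a) :
    (fun _ => x) ∈ (P.cubes n).grp a := by
  induction n with
  | zero => exact hx
  | succ n ih =>
    refine (P.mem_cubes_succ).2 ⟨ih, ?_⟩
    have : cubeDiff (fun _ : DiscreteCube (n + 1) => x) = 1 := by
      funext v; simp [cubeDiff]
    rw [this]
    exact one_mem _

/-- If the face fixes the first coordinate, the difference in that direction is again a face map, of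
codimension one less, which pays for the additional degree demanded of a difference. Otherwise the
two faces agree and the difference is trivial. -/
theorem face_mem_cubes {n a : ℕ} (J : Finset (Fin n)) (w : DiscreteCube n) {x : G}
    (hx : x ∈ P.grp (a + J.card)) :
    (cubeFace J w).mulIndicator (fun _ => x) ∈ (P.cubes n).grp a := by
  classical
  induction n generalizing a with
  | zero =>
    obtain rfl : J = ∅ := Finset.eq_empty_of_isEmpty J
    rw [P.mem_cubes_zero, Set.mulIndicator_of_mem]
    · simpa using hx
    · intro j; simp
  | succ n ih =>
    set J' : Finset (Fin n) := Finset.univ.filter (fun j => j.succ ∈ J) with hJ'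
    have hmem : ∀ (e : Fin 2) (v : DiscreteCube n), (Fin.cons e v : DiscreteCube (n + 1)) ∈
        cubeFace J w ↔ (0 ∈ J → e = w 0) ∧ v ∈ cubeFace J' (fun j => w j.succ) := by
      intro e v
      constructor
      · intro h
        refine ⟨fun h0 => by simpa using h 0 h0, fun j hj => ?_⟩
        have := h j.succ (by simpa [hJ'] using hj)
        simpa using this
      · rintro ⟨h0, h⟩ j hj
        refine Fin.cases (fun h0' => by simpa using h0 h0') (fun i hi => ?_) j hj
        simpa using h i (by simpa [hJ'] using hi)
    have hmap : J'.map (Fin.succEmb n) = J.erase 0 := by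
      ext j
      refine Fin.cases ?_ (fun i => ?_) j <;> simp [hJ']
    have hcard : J'.card = (J.erase 0).card := by rw [← hmap, Finset.card_map]
    have hface : ∀ e : Fin 2, (fun v : DiscreteCube n => (cubeFace J w).mulIndicator (fun _ => x)
        (Fin.cons e v : DiscreteCube (n + 1))) = if 0 ∈ J → e = w 0 then
          (cubeFace J' (fun j => w j.succ)).mulIndicator (fun _ => x) else 1 := by
      intro e
      funext v
      have h := hmem e v
      by_cases h0 : 0 ∈ J → e = w 0
      · rw [if_pos h0]
        by_cases hv : v ∈ cubeFace J' (fun j => w j.succ)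
        · rw [Set.mulIndicator_of_mem (h.2 ⟨h0, hv⟩), Set.mulIndicator_of_mem hv]
        · rw [Set.mulIndicator_of_notMem (fun h' => hv (h.1 h').2), Set.mulIndicator_of_notMem hv]
      · rw [if_neg h0, Set.mulIndicator_of_notMem (fun h' => h0 (h.1 h').1)]
        rfl
    have hdiff : cubeDiff ((cubeFace J w).mulIndicator (fun _ => x)) =
        (if 0 ∈ J → 0 = w 0 then
          (cubeFace J' (fun j => w j.succ)).mulIndicator (fun _ => x) else 1)⁻¹ *
        (if 0 ∈ J → 1 = w 0 then
          (cubeFace J' (fun j => w j.succ)).mulIndicator (fun _ => x) else 1) := by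
      rw [← hface 0, ← hface 1]; rfl
    rw [P.mem_cubes_succ, hdiff, hface 0]
    by_cases h0 : 0 ∈ J
    · have hc : J.card = J'.card + 1 := by
        rw [hcard, Finset.card_erase_add_one h0]
      have h1 : x ∈ P.grp (a + 1 + J'.card) := by
        rw [hc] at hx; convert hx using 2; omega
      have h2 := ih J' (fun j => w j.succ) h1
      have h3 := (P.cubes n).mem_of_le (Nat.le_succ a) h2
      have hw : (0 = w 0 ∧ ¬ 1 = w 0) ∨ (1 = w 0 ∧ ¬ 0 = w 0) := by
        generalize w 0 = e
        revert e; decide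
      rcases hw with ⟨h, h'⟩ | ⟨h, h'⟩
      · rw [if_pos (fun _ => h), if_neg (fun q => h' (q h0)), mul_one]
        exact ⟨h3, inv_mem h2⟩
      · rw [if_pos (fun _ => h), if_neg (fun q => h' (q h0)), inv_one, one_mul]
        exact ⟨one_mem _, h2⟩
    · have hc : J.card = J'.card := by
        rw [hcard, Finset.erase_eq_of_notMem h0]
      rw [if_pos (fun h => absurd h h0), if_pos (fun h => absurd h h0), inv_mul_cancel]
      exact ⟨ih _ _ (hc ▸ hx), one_mem _⟩

/-- Cubes with values in `A * Γ`, for a central subgroup `A` which is contained in every nontrivial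
term of the filtration, can be corrected by `A` to cubes with values in `Γ`. -/
theorem exists_cube_mem_of_mem_mul {A Γ : Subgroup G} (hA : A ≤ Subgroup.center G)
    (hAP : ∀ d, A ≤ P.grp d ∨ P.grp d = ⊥) {n a : ℕ} {c : DiscreteCube n → G}
    (hc : c ∈ (P.cubes n).grp a) (hcA : ∀ v, ∃ γ ∈ Γ, c v * γ⁻¹ ∈ A) :
    ∃ γ ∈ (P.cubes n).grp a, (∀ v, γ v ∈ Γ) ∧ ∀ v, c v * (γ v)⁻¹ ∈ A := by
  induction n generalizing a with
  | zero =>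
    -- If A lies in P_a, multiplying by A does not leave P_a. If P_a is trivial, so is the value of
    -- c, and γ = 1 serves.
    rcases hAP a with h | h
    · obtain ⟨γ, hγ, hγA⟩ := hcA default
      refine ⟨fun _ => γ, ?_, fun _ => hγ, fun v => ?_⟩
      · rw [P.mem_cubes_zero] at hc ⊢
        have := mul_mem (inv_mem (h hγA)) hc
        simpa using this
      · rwa [Subsingleton.elim v default]
    · refine ⟨1, one_mem _, fun _ => one_mem _, fun v => ?_⟩
      rw [P.mem_cubes_zero, h, Subgroup.mem_bot] at hc
      rw [Subsingleton.elim v default, hc]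
      simp [one_mem]
  | succ n ih =>
    rw [P.mem_cubes_succ] at hc
    obtain ⟨γ₀, hγ₀, hγ₀Γ, hγ₀A⟩ := ih hc.1 (fun v => hcA _)
    have hcomm : ∀ {x : G}, x ∈ A → ∀ y, y * x = x * y :=
      fun hx => Subgroup.mem_center_iff.1 (hA hx)
    -- The lower face and the difference are corrected separately and then glued. Since A is
    -- central, a quotient of two elements of AΓ is again in AΓ.
    obtain ⟨γ₁, hγ₁, hγ₁Γ, hγ₁A⟩ := ih hc.2 (fun v => by
      obtain ⟨γ, hγ, hγA⟩ := hcA (Fin.cons 0 v)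
      obtain ⟨δ, hδ, hδA⟩ := hcA (Fin.cons 1 v)
      refine ⟨γ⁻¹ * δ, mul_mem (inv_mem hγ) hδ, ?_⟩
      have h := mul_mem (inv_mem hγA) hδA
      have e1 := hcomm (inv_mem hγA) (γ⁻¹ * (c (Fin.cons 1 v) * δ⁻¹))
      have e2 := hcomm hδA γ⁻¹
      unfold cubeDiff
      generalize c (Fin.cons 0 v) = p at *
      generalize c (Fin.cons 1 v) = q at *
      convert h using 1
      have e3 := hcomm (mul_mem (inv_mem hγA) hδA) γ⁻¹
      calc p⁻¹ * q * (γ⁻¹ * δ)⁻¹ = (γ⁻¹ * ((p * γ⁻¹)⁻¹ * (q * δ⁻¹))) * γ := by group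
        _ = (p * γ⁻¹)⁻¹ * (q * δ⁻¹) := by rw [e3]; group)
    refine ⟨fun v => if v 0 = 0 then γ₀ (fun j => v j.succ) else
      γ₀ (fun j => v j.succ) * γ₁ (fun j => v j.succ), ?_, fun v => ?_, fun v => ?_⟩
    · rw [P.mem_cubes_succ]
      constructor
      · simpa using hγ₀
      · convert hγ₁ using 1
        funext v
        simp [cubeDiff]
    · dsimp only
      split_ifs
      · exact hγ₀Γ _
      · exact mul_mem (hγ₀Γ _) (hγ₁Γ _)
    · obtain ⟨e, v, rfl⟩ : ∃ e u, v = Fin.cons e u :=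
        ⟨v 0, fun j => v j.succ, (Fin.cons_self_tail v).symm⟩
      simp only [Fin.cons_zero, Fin.cons_succ]
      have hz := hγ₀A v
      have ho := hγ₁A v
      unfold cubeDiff at ho
      have he : e = 0 ∨ e = 1 := by revert e; decide
      rcases he with rfl | rfl
      · simpa using hz
      · rw [if_neg (by decide)]
        convert mul_mem hz ho using 1
        generalize c (Fin.cons 0 v) = p at *
        have e1 := hcomm ho p
        calc c (Fin.cons 1 v) * (γ₀ v * γ₁ v)⁻¹
            = (p * (p⁻¹ * c (Fin.cons 1 v) * (γ₁ v)⁻¹)) * (γ₀ v)⁻¹ := by group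
          _ = (p⁻¹ * c (Fin.cons 1 v) * (γ₁ v)⁻¹) * (p * (γ₀ v)⁻¹) := by rw [e1]; group
          _ = _ := (hcomm ho _).symm

end ProperFiltration

theorem cubeAlt_mul_of_mem_center {G : Type*} [Group G] {n : ℕ} (c d : DiscreteCube n → G)
    (hd : ∀ v, d v ∈ Subgroup.center G) : cubeAlt n (c * d) = cubeAlt n c * cubeAlt n d := by
  induction n with
  | zero => rfl
  | succ n ih =>
    have h : cubeDiff (c * d) = cubeDiff c * cubeDiff d := by
      funext v
      have := Subgroup.mem_center_iff.1 (inv_mem (hd (Fin.cons 0 v)))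
      simp only [cubeDiff, Pi.mul_apply, mul_inv_rev]
      simp only [mul_assoc]
      rw [← mul_assoc _ (c _) (d _), ← this]
      simp only [mul_assoc]
      rw [this]
    simp only [cubeAlt]
    rw [h]
    exact ih _ _ fun v => mul_mem (inv_mem (hd _)) (hd _)

theorem cubeAlt_mem_of_forall_mem {G : Type*} [Group G] {n : ℕ} {c : DiscreteCube n → G}
    {A : Subgroup G} (hc : ∀ v, c v ∈ A) : cubeAlt n c ∈ A := by
  induction n with
  | zero => exact hc _
  | succ n ih => exact ih fun v => mul_mem (inv_mem (hc _)) (hc _)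

/-! ### Iterated differences of maps on the real line -/

theorem map_nat_mul_of_map_add {G : Type*} [Group G] {h : ℝ → G}
    (hadd : ∀ x y, h (x + y) = h x * h y) (n : ℕ) (x : ℝ) : h (n * x) = h x ^ n := by
  induction n with
  | zero =>
    have := hadd 0 0
    rw [add_zero, left_eq_mul] at this
    simpa using this
  | succ n ih => rw [pow_succ, ← ih, ← hadd]; congr 1; push_cast; ring

theorem map_zero_of_map_add {G : Type*} [Group G] {h : ℝ → G}
    (hadd : ∀ x y, h (x + y) = h x * h y) : h 0 = 1 := by
  simpa using map_nat_mul_of_map_add hadd 0 0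

theorem map_neg_of_map_add {G : Type*} [Group G] {h : ℝ → G}
    (hadd : ∀ x y, h (x + y) = h x * h y) (x : ℝ) : h (-x) = (h x)⁻¹ := by
  rw [eq_inv_iff_mul_eq_one, ← hadd, neg_add_cancel, map_zero_of_map_add hadd]

/-- Two continuous homomorphisms on the real line agree if they agree at small dyadic numbers. -/
theorem eq_of_map_add_of_eq_dyadic {G : Type*} [Group G] [TopologicalSpace G] [T2Space G]
    {f h : ℝ → G} (hf : Continuous f) (hh : Continuous h)
    (fadd : ∀ x y, f (x + y) = f x * f y) (hadd : ∀ x y, h (x + y) = h x * h y)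
    (m₀ : ℕ) (heq : ∀ m ≥ m₀, f ((1 / 2) ^ m) = h ((1 / 2) ^ m)) : f = h := by
  -- The set of agreement is a closed subgroup with arbitrarily small positive elements, hence
  -- everything.
  let S : AddSubgroup ℝ :=
    { carrier := {x | f x = h x}
      zero_mem' := by
        simp [map_zero_of_map_add fadd, map_zero_of_map_add hadd]
      add_mem' := by
        intro x y hx hy
        simp only [Set.mem_ofPred_eq] at *
        rw [fadd, hadd, hx, hy]
      neg_mem' := by
        intro x hx
        simp only [Set.mem_ofPred_eq] at *
        rw [map_neg_of_map_add fadd, map_neg_of_map_add hadd, hx] }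
  have hclosed : IsClosed (S : Set ℝ) := isClosed_eq hf hh
  have hdense : Dense (S : Set ℝ) := by
    refine S.dense_of_not_isolated_zero fun ε hε => ?_
    obtain ⟨n, hn⟩ := exists_pow_lt_of_lt_one hε (by norm_num : (1 / 2 : ℝ) < 1)
    refine ⟨(1 / 2) ^ (max n m₀), heq _ (le_max_right _ _), by positivity, lt_of_le_of_lt ?_ hn⟩
    exact pow_le_pow_of_le_one (by norm_num) (by norm_num) (le_max_left _ _)
  funext x
  have : x ∈ closure (S : Set ℝ) := hdense x
  rwa [hclosed.closure_eq] at this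

/-- A continuous biadditive map on the reals which is trivial on `{1} × ℝ` is trivial. -/
theorem biadditive_eq_one {C : Type*} [CommGroup C] [TopologicalSpace C] [T2Space C]
    {w : ℝ → ℝ → C} (hw : ∀ y, Continuous fun x => w x y)
    (hl : ∀ x x' y, w (x + x') y = w x y * w x' y) (hr : ∀ x y y', w x (y + y') = w x y * w x y')
    (h1 : ∀ y, w 1 y = 1) (x y : ℝ) : w x y = 1 := by
  -- At dyadic points, w(2⁻ᵐ, y) = w(2⁻ᵐ, 2⁻ᵐy)^(2ᵐ) = w(1, 2⁻ᵐy) = 1, moving the factor 2ᵐ from one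
  -- argument to the other.
  have := eq_of_map_add_of_eq_dyadic (f := fun x => w x y) (h := fun _ => 1) (hw y)
    continuous_const (fun x x' => hl x x' y) (by simp) 0 (fun m _ => by
      have e1 := map_nat_mul_of_map_add (h := fun y => w ((1 / 2) ^ m) y)
        (fun y y' => hr _ y y') (2 ^ m) ((1 / 2) ^ m * y)
      have e2 := map_nat_mul_of_map_add (h := fun x => w x ((1 / 2) ^ m * y))
        (fun x x' => hl x x' _) (2 ^ m) ((1 / 2) ^ m)
      have e3 : ((2 ^ m : ℕ) : ℝ) * (1 / 2) ^ m = 1 := by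
        push_cast; rw [← mul_pow]; norm_num
      simp only [← mul_assoc, e3, one_mul] at e1 e2
      rw [e1, ← e2, h1])
  exact congrFun this x

/-- The difference of a map on the real line in the direction `z`. -/
def diffMap {G : Type*} [Group G] (z : ℝ) (f : ℝ → G) : ℝ → G := fun x => (f x)⁻¹ * f (x + z)

/-- Iterated differences of a map on the real line. -/
def diffList {G : Type*} [Group G] : List ℝ → (ℝ → G) → ℝ → G
  | [], f => f
  | z :: l, f => diffList l (diffMap z f)

section diffList

variable {G : Type*} [Group G] {C : Type*} [CommGroup C]

theorem diffMap_const_mul (z : ℝ) (a : G) (f : ℝ → G) :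
    diffMap z (fun x => a * f x) = diffMap z f := by
  funext x; simp [diffMap]

theorem diffMap_hom (φ : C →* G) (z : ℝ) (f : ℝ → C) :
    diffMap z (fun x => φ (f x)) = fun x => φ (diffMap z f x) := by
  funext x; simp [diffMap]

theorem diffList_hom (φ : C →* G) (l : List ℝ) (f : ℝ → C) :
    diffList l (fun x => φ (f x)) = fun x => φ (diffList l f x) := by
  induction l generalizing f with
  | nil => rfl
  | cons z l ih => rw [diffList, diffMap_hom, ih]; rfl

theorem diffMap_mul (z : ℝ) (f h : ℝ → C) : diffMap z (f * h) = diffMap z f * diffMap z h := by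
  funext x
  simp only [diffMap, Pi.mul_apply, mul_inv_rev]
  rw [mul_comm (h x)⁻¹, mul_mul_mul_comm]

theorem diffList_mul (l : List ℝ) (f h : ℝ → C) :
    diffList l (f * h) = diffList l f * diffList l h := by
  induction l generalizing f h with
  | nil => rfl
  | cons z l ih => rw [diffList, diffMap_mul, ih]; rfl

theorem diffList_translate (l : List ℝ) (f : ℝ → G) (a : ℝ) :
    diffList l (fun x => f (x + a)) = fun x => diffList l f (x + a) := by
  induction l generalizing f with
  | nil => rfl
  | cons z l ih =>
    have : diffMap z (fun x => f (x + a)) = fun x => diffMap z f (x + a) := by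
      funext x; simp only [diffMap, add_right_comm]
    rw [diffList, this, ih]; rfl

theorem diffMap_diffList (l : List ℝ) (f : ℝ → C) (z : ℝ) :
    diffMap z (diffList l f) = diffList l (diffMap z f) := by
  induction l generalizing f with
  | nil => rfl
  | cons y l ih =>
    rw [diffList, ih, diffList]
    congr 1
    funext x
    simp only [diffMap, mul_inv_rev, inv_inv, add_right_comm x y z]
    simp only [mul_comm, mul_left_comm, mul_assoc]

theorem continuous_diffList [TopologicalSpace G] [IsTopologicalGroup G] (l : List ℝ) {f : ℝ → G}
    (hf : Continuous f) : Continuous (diffList l f) := by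
  induction l generalizing f with
  | nil => exact hf
  | cons z l ih =>
    refine ih ?_
    unfold diffMap
    fun_prop

/-- Iterated differences depend continuously on a scaling parameter. -/
theorem continuous_diffList_smul [TopologicalSpace G] [IsTopologicalGroup G] (l : List ℝ)
    {f : ℝ → ℝ → G} (hf : Continuous fun p : ℝ × ℝ => f p.1 p.2) :
    Continuous fun p : ℝ × ℝ => diffList (l.map (p.1 * ·)) (f p.1) p.2 := by
  induction l generalizing f with
  | nil => exact hf
  | cons z l ih =>
    refine ih (f := fun s => diffMap (s * z) (f s)) ?_
    unfold diffMap
    have : Continuous fun p : ℝ × ℝ => f p.1 (p.2 + p.1 * z) :=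
      hf.comp (by fun_prop : Continuous fun p : ℝ × ℝ => (p.1, p.2 + p.1 * z))
    exact hf.inv.mul this

theorem diffList_one (l : List ℝ) : diffList l (fun _ => (1 : G)) = fun _ => 1 := by
  induction l with
  | nil => rfl
  | cons z l ih =>
    have : diffMap z (fun _ => (1 : G)) = fun _ => 1 := by funext x; simp [diffMap]
    rw [diffList, this, ih]

/-- A periodic polynomial cocycle on the real line does not depend on its first argument. -/
theorem periodic_cocycle_const [TopologicalSpace C] [IsTopologicalGroup C] [T2Space C]
    {U : ℝ → ℝ → C} (hU : ∀ y, Continuous (U y)) (hper : ∀ y x, U y (x + 1) = U y x)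
    (hco : ∀ x y z, U y x * U z (x + y) = U z y * U (y + z) x) (m : ℕ)
    (hpoly : ∀ l : List ℝ, l.length = m + 1 → ∀ y x, diffList l (U y) x = 1) (y x : ℝ) :
    U y x = U y 0 := by
  induction m with
  | zero =>
    have := hpoly [x] rfl y 0
    simp only [diffList, diffMap, zero_add] at this
    exact (inv_mul_eq_one.1 this).symm
  | succ m ih =>
    refine ih fun l hl => ?_
    obtain ⟨z, l, rfl⟩ := List.exists_cons_of_length_eq_add_one hl
    intro y x
    set T : ℝ → ℝ → C := fun y => diffList l (U y) with hT
    have hTc : ∀ y, Continuous (T y) := fun y => continuous_diffList l (hU y)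
    have hTper : ∀ y x, T y (x + 1) = T y x := by
      intro y x
      have := congrFun (diffList_translate l (U y) 1) x
      simp only [hper] at this
      exact this.symm
    -- Two further differences kill T, so T is affine in its real variable, with slope (T y 0)⁻¹ * T
    -- y z in direction z.
    have hlin : ∀ y x z, T y (x + z) = T y x * ((T y 0)⁻¹ * T y z) := by
      intro y x z
      have h := hpoly (x :: z :: l) (by simpa using hl) y 0
      rw [diffList, diffList, ← diffMap_diffList, ← diffMap_diffList] at h
      simp only [diffMap, zero_add, zero_add] at h
      have h2 : (T y 0)⁻¹ * T y x = (T y z)⁻¹ * T y (z + x) := inv_mul_eq_one.1 h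
      rw [eq_inv_mul_iff_mul_eq] at h2
      rw [add_comm, ← h2]
      simp only [mul_comm, mul_left_comm]
    -- The first factor on the right is not always 1, because `l` may be empty. It does not depend
    -- on `x`, so it cancels in slopes.
    have hTco : ∀ x y z, T y x * T z (x + y) = diffList l (fun _ => U z y) 0 * T (y + z) x := by
      intro x y z
      have h : (U y) * (fun x => U z (x + y)) = (fun _ => U z y) * U (y + z) := by
        funext x; exact hco x y z
      have h2 := congrArg (fun f => diffList l f x) h
      simp only [diffList_mul, diffList_translate, Pi.mul_apply] at h2
      rw [hT]
      simp only
      rw [h2]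
      congr 1
      have := congrFun (diffList_translate l (fun _ => U z y) x) 0
      rw [zero_add] at this
      exact this.symm
    -- The slope is additive in the direction because T is affine, additive in y by the cocycle
    -- identity, and trivial in direction 1 by periodicity.
    have key := biadditive_eq_one (w := fun z y => (T y 0)⁻¹ * T y z)
      (fun y => continuous_const.mul (hTc y))
      (fun x x' y => by rw [hlin y x x', mul_assoc])
      (fun x y y' => by
        have e1 := hTco x y y'
        have e2 := hTco 0 y y'
        rw [add_comm x y, hlin y' y x] at e1
        rw [zero_add] at e2
        generalize diffList l (fun _ => U y' y) 0 = K at *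
        have e3 : T (y + y') x = K⁻¹ * (T y x * (T y' y * ((T y' 0)⁻¹ * T y' x))) := by
          rw [e1, inv_mul_cancel_left]
        have e4 : T (y + y') 0 = K⁻¹ * (T y 0 * T y' y) := by
          rw [e2, inv_mul_cancel_left]
        rw [e3, e4]
        simp only [mul_inv_rev, inv_inv]
        generalize T y' y = p
        generalize T y' 0 = q
        generalize T y 0 = r
        generalize T y x = s
        generalize T y' x = t
        calc _ = r⁻¹ * s * (q⁻¹ * t) * (K * K⁻¹) * (p * p⁻¹) := by
              simp only [mul_comm, mul_left_comm, mul_assoc]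
          _ = _ := by simp)
      (fun y => by
        have := hTper y 0
        rw [zero_add] at this
        simp only [this, inv_mul_cancel])
      z y
    rw [diffList, ← diffMap_diffList]
    show (T y x)⁻¹ * T y (x + z) = 1
    rw [hlin, key, mul_one, inv_mul_cancel]

end diffList

/-- A polynomial map on the real line which is a homomorphism modulo a central subgroup and
commutes with the translation by `1` is a homomorphism. -/
theorem map_add_of_polynomial_of_periodic {G : Type*} [Group G] [TopologicalSpace G]
    [IsTopologicalGroup G] [T2Space G] {g : ℝ → G} (hg : Continuous g)
    (hcen : ∀ x y, (g x * g y)⁻¹ * g (x + y) ∈ Subgroup.center G)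
    (hper : ∀ x, g (x + 1) = g x * g 1) (m : ℕ)
    (hpoly : ∀ l : List ℝ, l.length = m + 2 → ∀ x, diffList l g x = 1) (x y : ℝ) :
    g (x + y) = g x * g y := by
  have g0 : g 0 = 1 := by
    have := hper 0
    rwa [zero_add, right_eq_mul] at this
  set U : ℝ → ℝ → Subgroup.center G := fun y x => ⟨(g x * g y)⁻¹ * g (x + y), hcen x y⟩ with hUdef
  have hgU : ∀ x y, g (x + y) = g x * g y * U y x := fun x y => by
    simp only [hUdef, mul_inv_cancel_left]
  have hc : ∀ (a : Subgroup.center G) (b : G), b * a = a * b := fun a =>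
    Subgroup.mem_center_iff.1 a.2
  have hcc : ∀ a b : Subgroup.center G, a * b = b * a := fun a b => Subtype.ext (hc b a)
  let _ : CommGroup (Subgroup.center G) := { (inferInstance : Group (Subgroup.center G)) with
    mul_comm := hcc }
  have hUc : ∀ y, Continuous (U y) := fun y => by
    refine Continuous.subtype_mk ?_ _
    fun_prop
  have hBeq : ∀ x y, ⁅g x, g y⁆ = (U x y * (U y x)⁻¹ : Subgroup.center G) := by
    intro x y
    have h1 := hgU x y
    rw [add_comm, hgU y x] at h1
    rw [commutatorElement_def, mul_inv_eq_iff_eq_mul, mul_inv_eq_iff_eq_mul, ← hc _ (g y),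
      mul_assoc, ← hc _ (g x), ← mul_assoc, Subgroup.coe_mul, ← mul_assoc, h1, Subgroup.coe_inv,
      mul_inv_cancel_right]
  set B : ℝ → ℝ → Subgroup.center G := fun x y => U x y * (U y x)⁻¹ with hBdef
  have hBeq' : ∀ x y, ⁅g x, g y⁆ = B x y := hBeq
  have hBl : ∀ x x' y, B (x + x') y = B x y * B x' y := by
    intro x x' y
    apply Subtype.ext
    change (B (x + x') y : G) = (B x y : G) * (B x' y : G)
    rw [← hBeq', ← hBeq', ← hBeq', hgU x x']
    have h1 : ⁅g x * g x' * U x' x, g y⁆ = ⁅g x * g x', g y⁆ := by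
      rw [commutatorElement_def, commutatorElement_def, mul_assoc _ _ (g y), ← hc _ (g y)]
      group
    have h2 : ⁅g x * g x', g y⁆ = g x * ⁅g x', g y⁆ * (g x)⁻¹ * ⁅g x, g y⁆ := by
      simp only [commutatorElement_def]; group
    rw [h1, h2, hBeq' x' y, hc, mul_inv_cancel_right, ← hc]
  have hBanti : ∀ x y, B x y = (B y x)⁻¹ := fun x y => by simp [hBdef]
  have hBr : ∀ x y y', B x (y + y') = B x y * B x y' := by
    intro x y y'
    rw [hBanti, hBl, mul_inv_rev, ← hBanti, ← hBanti, hcc]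
  -- B is biadditive with trivial diagonal, so B(1, 2⁻ᵐ) = B(2⁻ᵐ, 2⁻ᵐ)^(2ᵐ) = 1. Thus g 1 commutes
  -- with all values of g, which is what makes U periodic.
  have hB1 : ∀ y, B y 1 = 1 := by
    have := eq_of_map_add_of_eq_dyadic (f := fun y => B 1 y) (h := fun _ => 1)
      (by
        rw [continuous_induced_rng]
        have : (Subtype.val ∘ fun y => B 1 y) = fun y => ⁅g 1, g y⁆ := by
          funext y; exact (hBeq 1 y).symm
        rw [this]
        simp only [commutatorElement_def]
        fun_prop)
      continuous_const (hBr 1) (by simp) 0 (fun m _ => by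
        have e2 := map_nat_mul_of_map_add (h := fun x => B x ((1 / 2) ^ m))
          (fun x x' => hBl x x' _) (2 ^ m) ((1 / 2) ^ m)
        have e3 : ((2 ^ m : ℕ) : ℝ) * (1 / 2) ^ m = 1 := by
          push_cast; rw [← mul_pow]; norm_num
        simp only [e3] at e2
        rw [e2, hBdef]
        simp)
    intro y
    rw [hBanti, congrFun this y, inv_one]
  have hUone : ∀ x, U 1 x = 1 := fun x => Subtype.ext (by simp [hUdef, hper])
  have hcomm1 : ∀ y, g 1 * g y = g y * g 1 := by
    intro y
    have := hBeq' y 1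
    rw [hB1] at this
    exact (commutatorElement_eq_one_iff_mul_comm.1 this).symm
  have hUper : ∀ y x, U y (x + 1) = U y x := by
    intro y x
    apply Subtype.ext
    simp only [hUdef]
    rw [add_right_comm, hper, hper, mul_assoc (g x), hcomm1]
    simp only [mul_inv_rev, mul_assoc]
    rw [← mul_assoc (g x)⁻¹ _ (g 1)]
    have h := hcomm1 y
    have h1 := hgU x y
    rw [h1]
    simp only [mul_assoc]
    rw [← hc]
    simp
  have hco : ∀ x y z, U y x * U z (x + y) = U z y * U (y + z) x := by
    intro x y z
    apply Subtype.ext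
    have h1 := hgU (x + y) z
    rw [add_assoc, hgU x (y + z), hgU y z, hgU x y] at h1
    push_cast
    have h2 : g x * g y * g z * (U z y * U (y + z) x : G) =
        g x * g y * g z * (U y x * U z (x + y) : G) := by
      calc _ = g x * (g y * g z * U z y) * U (y + z) x := by group
        _ = g x * g y * U y x * g z * U z (x + y) := h1
        _ = _ := by rw [mul_assoc _ (U y x : G) (g z), ← hc (U y x)]; group
    exact (mul_left_cancel h2).symm
  have hUpoly : ∀ l : List ℝ, l.length = m + 1 → ∀ y x, diffList l (U y) x = 1 := by
    intro l hl y x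
    have h := hpoly (y :: l) (by simp [hl]) x
    -- The constant left factor g y disappears at the next difference, so U y has degree one less
    -- than g.
    have e1 : diffMap y g = fun x => g y * (Subgroup.center G).subtype (U y x) := by
      funext x
      simp only [diffMap, hgU x y, Subgroup.coe_subtype]
      group
    obtain ⟨z, l, rfl⟩ := List.exists_cons_of_length_eq_add_one hl
    rw [diffList, e1, diffList, diffMap_const_mul] at h
    have e2 := congrFun (diffList_hom (Subgroup.center G).subtype (z :: l) (U y)) x
    rw [diffList] at e2
    rw [e2] at h
    exact Subtype.ext h
  have := periodic_cocycle_const hUc hUper hco m hUpoly y x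
  rw [hgU, this]
  have h0 : U y 0 = 1 := Subtype.ext (by simp [hUdef, g0])
  rw [h0]; simp

/-! ### Morphisms from the circle come from one-parameter subgroups -/

theorem diffList_ofFn_eq_cubeAlt {G : Type*} [Group G] {n : ℕ} (t : Fin n → ℝ) (g : ℝ → G)
    (x : ℝ) : diffList (List.ofFn t) g x =
      cubeAlt n (fun v => g (x + ∑ i, ((v i : ℕ) : ℝ) * t i)) := by
  induction n generalizing g with
  | zero => simp [diffList, cubeAlt]
  | succ n ih =>
    rw [List.ofFn_succ, diffList, ih, cubeAlt]
    congr 1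
    funext v
    simp only [diffMap, cubeDiff, Fin.sum_univ_succ, Fin.cons_zero, Fin.cons_succ, Fin.val_zero,
      Fin.val_one]
    congr 2
    · simp
    · push_cast; ring

namespace ProperFiltration

variable {G : Type*} [Group G]

/-- The image of a filtration under a homomorphism. -/
def map (P : ProperFiltration G) {H : Type*} [Group H] (f : G →* H) : ProperFiltration H where
  grp a := (P.grp a).map f
  antitone _ _ hab := Subgroup.map_mono (P.antitone hab)
  commutator_mem := by
    rintro a b _ _ ⟨x, hx, rfl⟩ ⟨y, hy, rfl⟩
    rw [← map_commutatorElement]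
    exact Subgroup.mem_map_of_mem _ (P.commutator_mem hx hy)

/-- A map which is a homomorphism modulo a central subgroup `A` agrees on affine cubes with a cube
up to elements of `A`. -/
theorem exists_cube_of_map_add (P : ProperFiltration G) (h1 : P.grp 1 = ⊤) {A : Subgroup G}
    (hA : A ≤ Subgroup.center G) {g : ℝ → G} (hg : ∀ x y, (g x * g y)⁻¹ * g (x + y) ∈ A) {n : ℕ}
    (x : ℝ) (t : Fin n → ℝ) : ∃ c ∈ (P.cubes n).grp 0,
      ∀ v, (c v)⁻¹ * g (x + ∑ i, ((v i : ℕ) : ℝ) * t i) ∈ A := by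
  have htop : ∀ y, y ∈ P.grp 1 := fun y => h1 ▸ Subgroup.mem_top y
  induction n with
  | zero => exact ⟨fun _ => g x, P.mem_of_le (Nat.zero_le 1) (htop _), fun v => by simp [one_mem]⟩
  | succ n ih =>
    obtain ⟨c, hc, hcA⟩ := ih (fun i => t i.succ)
    -- The difference in the new direction is the constant g (t 0). It must have degree 1, whence
    -- the hypothesis that P_1 is the whole group.
    refine ⟨fun v => c (fun j => v j.succ) * g (t 0) ^ (v 0 : ℕ), ?_, fun v => ?_⟩
    · rw [P.mem_cubes_succ]
      constructor
      · simpa using hc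
      · convert P.const_mem_cubes n (htop (g (t 0))) using 1
        funext v
        simp [cubeDiff]
    · rw [Fin.sum_univ_succ]
      have := hcA (fun j => v j.succ)
      have he : v 0 = 0 ∨ v 0 = 1 := by generalize v 0 = e; revert e; decide
      rcases he with he | he
      · simpa [he] using this
      · simp only [he, Fin.val_one, Nat.cast_one, one_mul, pow_one]
        rw [add_comm (t 0), ← add_assoc]
        generalize x + ∑ i, ((v (Fin.succ i) : ℕ) : ℝ) * t (Fin.succ i) = y at *
        have h2 := mul_mem this (hg y (t 0))
        convert h2 using 1
        have h3 := Subgroup.mem_center_iff.1 (hA this) (g (t 0))⁻¹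
        generalize c (fun j => v j.succ) = p at *
        calc (p * g (t 0))⁻¹ * g (y + t 0)
            = ((g (t 0))⁻¹ * (p⁻¹ * g y)) * ((g y)⁻¹ * g (y + t 0)) := by group
          _ = _ := by rw [h3]; group

/-- A lift to a filtered group of a map which respects cubes is a homomorphism if it is one modulo a
central subgroup. -/
theorem map_add_of_cubes [TopologicalSpace G] [IsTopologicalGroup G] [T2Space G]
    (P : ProperFiltration G) (h1 : P.grp 1 = ⊤) {D : ℕ} (hD : P.grp D = ⊥)
    {A Γ : Subgroup G} (hA : A ≤ Subgroup.center G) (hAP : ∀ d, A ≤ P.grp d ∨ P.grp d = ⊥)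
    [DiscreteTopology Γ] {g : ℝ → G} (hg : Continuous g)
    (hgA : ∀ x y, (g x * g y)⁻¹ * g (x + y) ∈ A) (hper : ∀ x, g (x + 1) = g x * g 1)
    (hcube : ∀ (n : ℕ) (x : ℝ) (t : Fin n → ℝ), ∃ b ∈ (P.cubes n).grp 0,
      ∀ v, (b v)⁻¹ * g (x + ∑ i, ((v i : ℕ) : ℝ) * t i) ∈ Γ) (x y : ℝ) :
    g (x + y) = g x * g y := by
  have hmem : ∀ l : List ℝ, D ≤ l.length → ∀ x, diffList l g x ∈ Γ := by
    intro l hl x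
    obtain ⟨n, t, rfl⟩ : ∃ (n : ℕ) (t : Fin n → ℝ), l = List.ofFn t :=
      ⟨l.length, l.get, (List.ofFn_get l).symm⟩
    rw [List.length_ofFn] at hl
    rw [diffList_ofFn_eq_cubeAlt]
    -- The values q of g agree with a cube c modulo A and with a cube b modulo Γ. So c⁻¹b takes
    -- values in AΓ and is corrected to a cube γ in Γ. In q = bγ⁻¹ · (γb⁻¹q) the first factor is a
    -- cube, with trivial alternating product as n ≥ D; the second takes values in Γ and, being
    -- (c⁻¹bγ⁻¹)⁻¹ · c⁻¹q, also in A.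
    obtain ⟨c, hc, hcA⟩ := P.exists_cube_of_map_add h1 hA hgA x t
    obtain ⟨b, hb, hbΓ⟩ := hcube n x t
    set q : DiscreteCube n → G := fun v => g (x + ∑ i, ((v i : ℕ) : ℝ) * t i) with hq
    obtain ⟨γ, hγ, hγΓ, hγA⟩ := P.exists_cube_mem_of_mem_mul (Γ := Γ) hA hAP
      (mul_mem (inv_mem hc) hb) (fun v => ⟨_, inv_mem (hbΓ v), by
        convert hcA v using 1
        simp only [Pi.mul_apply, Pi.inv_apply]
        group⟩)
    have hqe : q = b * γ⁻¹ * (γ * (b⁻¹ * q)) := by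
      funext v; simp only [Pi.mul_apply, Pi.inv_apply]; group
    have hΓ : ∀ v, (γ * (b⁻¹ * q)) v ∈ Γ := fun v => mul_mem (hγΓ v) (hbΓ v)
    have hcen : ∀ v, (γ * (b⁻¹ * q)) v ∈ Subgroup.center G := by
      intro v
      have := hA (mul_mem (inv_mem (hγA v)) (hcA v))
      convert this using 1
      simp only [Pi.mul_apply, Pi.inv_apply, hq]
      group
    rw [hqe, cubeAlt_mul_of_mem_center _ _ hcen]
    refine mul_mem ?_ (cubeAlt_mem_of_forall_mem hΓ)
    have := P.mem_of_le (show D ≤ 0 + n by omega) (P.cubeAlt_mem (mul_mem hb (inv_mem hγ)))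
    rw [hD, Subgroup.mem_bot] at this
    rw [this]
    exact one_mem _
  refine map_add_of_polynomial_of_periodic hg (fun x y => hA (hgA x y)) hper D ?_ x y
  intro l hl x
  obtain ⟨z, l, rfl⟩ := List.exists_cons_of_length_eq_add_one hl
  -- Scaling all steps by s gives a continuous path in the discrete group Γ. It is constant, and at
  -- s = 0 the difference is trivial.
  have hcont : Continuous fun s : ℝ =>
      (⟨diffList ((z :: l).map (s * ·)) g x, hmem _ (by rw [List.length_map]; omega) x⟩ : Γ) := by
    refine Continuous.subtype_mk ?_ _
    exact (continuous_diffList_smul (z :: l) (f := fun _ => g) (hg.comp continuous_snd)).comp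
      (by fun_prop : Continuous fun s : ℝ => (s, x))
  have := congrArg Subtype.val (PreconnectedSpace.constant inferInstance hcont (x := 1) (y := 0))
  have h0 : diffMap 0 g = fun _ => 1 := by funext x; simp [diffMap]
  simpa [diffList, h0, diffList_one] using this

end ProperFiltration

/-- The set Γ \ N is closed and misses N. Compactness of N/(N ∩ Γ) yields one neighbourhood U of 1
such that every element of Γ in NU lies in N; the image of U then meets the image of Γ only in 1. -/
theorem discreteTopology_map_mk' {G : Type*} [Group G] [TopologicalSpace G] [IsTopologicalGroup G]
    [T2Space G] (N Γ : Subgroup G) [N.Normal] [DiscreteTopology Γ]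
    [CompactSpace (N ⧸ Γ.subgroupOf N)] : DiscreteTopology (Γ.map (QuotientGroup.mk' N)) := by
  have hclosed : IsClosed {γ : G | γ ∈ Γ ∧ γ ∉ N} := by
    have hΓ : IsClosed (Γ : Set G) := Γ.isClosed_of_discrete
    have := hΓ.isClosedEmbedding_subtypeVal.isClosedMap {γ : Γ | (γ : G) ∉ N}
      (isClosed_discrete _)
    convert this using 1
    ext γ
    simp [and_comm]
  have key : ∃ U ∈ 𝓝 (1 : G), ∀ n : N, (QuotientGroup.mk n : N ⧸ Γ.subgroupOf N) ∈ Set.univ →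
      ∀ u ∈ U, (n : G)⁻¹ * u ∈ Γ → (n : G)⁻¹ * u ∈ N := by
    refine isCompact_univ.induction_on (p := fun S => ∃ U ∈ 𝓝 (1 : G), ∀ n : N,
      (QuotientGroup.mk n : N ⧸ Γ.subgroupOf N) ∈ S → ∀ u ∈ U, (n : G)⁻¹ * u ∈ Γ →
        (n : G)⁻¹ * u ∈ N) ⟨Set.univ, Filter.univ_mem, by simp⟩ ?_ ?_ ?_
    · rintro S T hST ⟨U, hU, h⟩
      exact ⟨U, hU, fun n hn => h n (hST hn)⟩
    · rintro S T ⟨U, hU, h⟩ ⟨W, hW, h'⟩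
      refine ⟨U ∩ W, Filter.inter_mem hU hW, fun n hn u hu => ?_⟩
      rcases hn with hn | hn
      · exact h n hn u hu.1
      · exact h' n hn u hu.2
    · intro q _
      obtain ⟨κ, rfl⟩ := QuotientGroup.mk_surjective q
      have h1 : ∀ᶠ p : N × G in 𝓝 (κ, 1), (p.1 : G)⁻¹ * p.2 ∉ {γ : G | γ ∈ Γ ∧ γ ∉ N} := by
        have hc : Continuous fun p : N × G => (p.1 : G)⁻¹ * p.2 := by fun_prop
        refine hc.continuousAt.eventually (hclosed.isOpen_compl.mem_nhds ?_)
        simp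
      rw [nhds_prod_eq, Filter.eventually_prod_iff] at h1
      obtain ⟨pa, hpa, pb, hpb, h⟩ := h1
      refine ⟨QuotientGroup.mk '' {n | pa n}, mem_nhdsWithin_of_mem_nhds
        (QuotientGroup.isOpenMap_coe.image_mem_nhds hpa), {u | pb u}, hpb, ?_⟩
      rintro n ⟨y, hy, hyn⟩ u hu hΓ
      rw [QuotientGroup.eq, Subgroup.mem_subgroupOf] at hyn
      have h2 := h hy hu
      simp only [Set.mem_ofPred_eq, not_and, not_not] at h2
      -- The condition depends only on the coset of n modulo N ∩ Γ, so it passes from the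
      -- representative y to n.
      have e : (y : G)⁻¹ * u = ((y⁻¹ * n : N) : G) * ((n : G)⁻¹ * u) := by push_cast; group
      have h3 := h2 (e ▸ mul_mem hyn hΓ)
      rw [e] at h3
      exact (Subgroup.mul_mem_cancel_left _ (y⁻¹ * n).2).1 h3
  obtain ⟨U, hU, hUN⟩ := key
  refine discreteTopology_of_isOpen_singleton_one (isOpen_iff_mem_nhds.2 ?_)
  rintro _ rfl
  rw [nhds_subtype, Filter.mem_comap]
  refine ⟨QuotientGroup.mk' N '' U, QuotientGroup.isOpenMap_coe.image_mem_nhds hU, ?_⟩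
  rintro ⟨_, γ, hγ, rfl⟩ ⟨u, hu, huγ⟩
  have h1 : γ⁻¹ * u ∈ N := QuotientGroup.eq.1 huγ.symm
  have h2 := hUN ⟨u * γ⁻¹, (Subgroup.Normal.mem_comm_iff inferInstance).1 h1⟩ (Set.mem_univ _) u hu
  simp only [mul_inv_rev, inv_inv, inv_mul_cancel_right] at h2
  exact Subtype.ext ((QuotientGroup.eq_one_iff γ).2 (h2 hγ))

/-! ### The given filtration and its cubes -/

namespace GroupFiltration

variable {F : Type*} [Group F] {k : ℕ} (V : GroupFiltration F k)

theorem grp_eq_bot {i : ℕ} (h : k ≤ i) : V.grp i = ⊥ :=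
  le_bot_iff.1 (V.grp_last ▸ V.antitone h)

theorem commutator_mem {i : ℕ} {x : F} (hx : x ∈ V.grp i) (y : F) : ⁅y, x⁆ ∈ V.grp (i + 1) := by
  rcases lt_or_ge i k with h | h
  · exact V.commutator_le i h (Subgroup.commutator_mem_commutator (Subgroup.mem_top y) hx)
  · rw [V.grp_eq_bot h, Subgroup.mem_bot] at hx
    rw [hx, commutatorElement_one_right]
    exact one_mem _

theorem commutator_mem' {i : ℕ} {x : F} (hx : x ∈ V.grp i) (y : F) : ⁅x, y⁆ ∈ V.grp (i + 1) := by
  rw [← commutatorElement_inv]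
  exact inv_mem (V.commutator_mem hx y)

instance normal (i : ℕ) : (V.grp i).Normal where
  conj_mem x hx y := by
    have := mul_mem (V.antitone (Nat.le_succ i) (V.commutator_mem hx y)) hx
    rwa [commutatorElement_def, inv_mul_cancel_right] at this

/-- A proper filtration whose cubes include the cubes of `V`. -/
def toProper : ProperFiltration F where
  -- The hypothesis directly gives only [F_i, F_j] ≤ F_{max(i,j)+1}. Degrees are therefore spaced
  -- exponentially, using log₂(a+b) ≤ max(log₂ a, log₂ b) + 1. As log₂ 0 = log₂ 1 = 0, degree 1 is
  -- still all of F.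
  grp d := V.grp (Nat.log 2 d)
  antitone _ _ h := V.antitone (Nat.log_mono_right h)
  commutator_mem := by
    intro a b x y hx hy
    have hlog : Nat.log 2 (a + b) ≤ max (Nat.log 2 a) (Nat.log 2 b) + 1 := by
      rcases Nat.eq_zero_or_pos (a + b) with h | h
      · simp [h]
      · refine Nat.lt_succ_iff.1 (Nat.log_lt_of_lt_pow h.ne' ?_)
        have ha := Nat.lt_pow_succ_log_self (b := 2) (by norm_num) a
        have hb := Nat.lt_pow_succ_log_self (b := 2) (by norm_num) b
        have ha' : 2 ^ (Nat.log 2 a).succ ≤ 2 ^ (max (Nat.log 2 a) (Nat.log 2 b) + 1) :=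
          Nat.pow_le_pow_right (by norm_num) (by simp)
        have hb' : 2 ^ (Nat.log 2 b).succ ≤ 2 ^ (max (Nat.log 2 a) (Nat.log 2 b) + 1) :=
          Nat.pow_le_pow_right (by norm_num) (by simp)
        rw [Nat.succ_eq_add_one, pow_succ 2 (max _ _ + 1)]
        omega
    refine V.antitone hlog ?_
    rcases le_total (Nat.log 2 a) (Nat.log 2 b) with h | h
    · rw [max_eq_right h]; exact V.commutator_mem hy x
    · rw [max_eq_left h]; exact V.commutator_mem' hx y

/-- It suffices to check generators, where a face of codimension at most i + 1 carries an element of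
F_i; the inequality log₂(i + 1) ≤ i is what is needed. -/
theorem comp_mem_cubes {H : Type*} [Group H] (f : F →* H) {n : ℕ} {b : DiscreteCube n → F}
    (hb : b ∈ cubeGroup V n) : (fun v => f (b v)) ∈ ((V.toProper.map f).cubes n).grp 0 := by
  have h : cubeGroup V n ≤ (((V.toProper.map f).cubes n).grp 0).comap
      (f.compLeft (DiscreteCube n)) := by
    rw [cubeGroup, Subgroup.closure_le]
    rintro _ ⟨i, J, w, x, hJ, hx, rfl⟩
    have hx' : f x ∈ (V.toProper.map f).grp (0 + J.card) := by
      refine Subgroup.mem_map_of_mem _ (V.antitone ?_ hx)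
      rw [zero_add]
      exact (Nat.log_mono_right hJ).trans
        (Nat.lt_succ_iff.1 (Nat.log_lt_self 2 (Nat.succ_ne_zero i)))
    have := (V.toProper.map f).face_mem_cubes J w hx'
    simp only [SetLike.mem_coe, Subgroup.mem_comap]
    convert this using 1
    funext v
    classical
    simp only [MonoidHom.compLeft_apply, Function.comp_apply, Set.mulIndicator_apply]
    split_ifs <;> simp
  exact h hb

end GroupFiltration

theorem coe_mem_abelianCubes (n : ℕ) (x : ℝ) (t : Fin n → ℝ) :
    (fun v : DiscreteCube n => ((x + ∑ i, ((v i : ℕ) : ℝ) * t i : ℝ) : UnitAddCircle)) ∈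
      abelianCubes UnitAddCircle n := by
  refine ⟨x, ?_, fun v => ?_⟩
  · exact (QuotientAddGroup.mk' _).comp
      { toFun := fun a : Fin n → ℤ => ∑ i, (a i : ℝ) * t i
        map_zero' := by simp
        map_add' := by intro a b; simp [add_mul, Finset.sum_add_distrib] }
  · simp

theorem OneParameterSubgroup.map_add {F : Type*} [Group F] [TopologicalSpace F]
    (f : OneParameterSubgroup F) (x y : ℝ) :
    f (Multiplicative.ofAdd (x + y)) = f (Multiplicative.ofAdd x) * f (Multiplicative.ofAdd y) := by
  rw [ofAdd_add, _root_.map_mul]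

theorem OneParameterSubgroup.continuous_ofAdd {F : Type*} [Group F] [TopologicalSpace F]
    (f : OneParameterSubgroup F) :
    Continuous fun x : ℝ => f (Multiplicative.ofAdd x) :=
  f.continuous_toFun.comp _root_.continuous_ofAdd

/-- The one-parameter subgroup given by a continuous additive map. -/
def OneParameterSubgroup.mk' {F : Type*} [Group F] [TopologicalSpace F] (g : ℝ → F)
    (hg : Continuous g) (hadd : ∀ x y, g (x + y) = g x * g y) : OneParameterSubgroup F where
  toFun x := g x.toAdd
  map_one' := map_zero_of_map_add hadd
  map_mul' _ _ := hadd _ _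
  continuous_toFun := hg.comp continuous_toAdd

theorem const_mem_cubeGroup {F : Type*} [Group F] {k : ℕ}
    (V : GroupFiltration F k) (n : ℕ) (x : F) :
    (fun _ => x) ∈ cubeGroup V n := by
  refine Subgroup.subset_closure ⟨0, ∅, default, x, by simp, V.grp_zero ▸ Subgroup.mem_top x, ?_⟩
  funext v
  rw [Set.mulIndicator_of_mem]
  intro j; simp

/-- The map is g(x) times the product of the g(t_i)^(v_i), and each such factor is a step on the
face v_i = 1 by an element of F_0 = F. -/
theorem map_sum_mem_cubeGroup {F : Type*} [Group F] {k : ℕ}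
    (V : GroupFiltration F k) {g : ℝ → F}
    (hadd : ∀ x y, g (x + y) = g x * g y) {n : ℕ} (x : ℝ) (t : Fin n → ℝ) (s : Finset (Fin n)) :
    (fun v : DiscreteCube n => g (x + ∑ i ∈ s, ((v i : ℕ) : ℝ) * t i)) ∈ cubeGroup V n := by
  classical
  induction s using Finset.induction_on with
  | empty => simpa using const_mem_cubeGroup V n (g x)
  | insert j s hj ih =>
    have hface : (cubeFace {j} (fun _ => 1)).mulIndicator (fun _ => g (t j)) ∈ cubeGroup V n :=
      Subgroup.subset_closure ⟨0, {j}, fun _ => 1, g (t j), by simp,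
        V.grp_zero ▸ Subgroup.mem_top _, rfl⟩
    convert mul_mem ih hface using 1
    funext v
    rw [Finset.sum_insert hj, add_comm (_ * t j), ← add_assoc, hadd, Pi.mul_apply]
    congr 1
    have he : v j = 0 ∨ v j = 1 := by generalize v j = e; revert e; decide
    rcases he with he | he
    · rw [Set.mulIndicator_of_notMem]
      · simp [he, map_zero_of_map_add hadd]
      · simp [cubeFace, he]
    · rw [Set.mulIndicator_of_mem]
      · simp [he]
      · simp [cubeFace, he]

/-- The quotient f⁻¹f' is a continuous path in the discrete group Γ that starts at 1. -/
theorem OneParameterSubgroup.eq_of_isInducedBy {F : Type*} [Group F] [TopologicalSpace F]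
    [IsTopologicalGroup F] {Γ : Subgroup F} [DiscreteTopology Γ]
    {φ : UnitAddCircle → F ⧸ Γ} {f f' : OneParameterSubgroup F} (h : IsInducedBy φ f)
    (h' : IsInducedBy φ f') : f = f' := by
  have hmem : ∀ x : ℝ, (f (Multiplicative.ofAdd x))⁻¹ * f' (Multiplicative.ofAdd x) ∈ Γ :=
    fun x => QuotientGroup.eq.1 ((h x).symm.trans (h' x))
  have hcont : Continuous fun x : ℝ => (⟨_, hmem x⟩ : Γ) :=
    Continuous.subtype_mk (f.continuous_ofAdd.inv.mul f'.continuous_ofAdd) _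
  ext x
  have := congrArg Subtype.val
    (PreconnectedSpace.constant inferInstance hcont (x := x.toAdd) (y := 0))
  simp only [ofAdd_zero, map_one, inv_one, one_mul] at this
  exact inv_mul_eq_one.1 this

/-! ### Lifting circle morphisms to one-parameter subgroups -/

section Circle

variable {F : Type*} [Group F] [TopologicalSpace F] [IsTopologicalGroup F] [T2Space F] {k : ℕ}

/-- A lift to `F` of a circle morphism is a homomorphism. -/
theorem map_add_of_cubeGroup (V : GroupFiltration F k) (hclosed : ∀ i, IsClosed (V.grp i : Set F))
    (Γ : Subgroup F) [DiscreteTopology Γ] (hΓ : CocompactIn Γ V) {g : ℝ → F} (hg : Continuous g)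
    (hper : ∀ x, g (x + 1) = g x * g 1)
    (hcube : ∀ (n : ℕ) (x : ℝ) (t : Fin n → ℝ), ∃ b ∈ cubeGroup V n,
      ∀ v, (b v)⁻¹ * g (x + ∑ i, ((v i : ℕ) : ℝ) * t i) ∈ Γ) (x y : ℝ) :
    g (x + y) = g x * g y := by
  -- To pass from i to i + 1, work in F/F_{i+1}: it is Hausdorff as F_{i+1} is closed, F_i becomes
  -- central, and Γ stays discrete. Degree 2ᵏ of the exponentially spaced filtration is trivial.
  have key : ∀ i ≤ k, ∀ x y, (g x * g y)⁻¹ * g (x + y) ∈ V.grp i := by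
    intro i hi
    induction i with
    | zero => intro x y; rw [V.grp_zero]; exact Subgroup.mem_top _
    | succ i ih =>
      intro x y
      have hci := hclosed (i + 1)
      have := hΓ (i + 1) hi
      have := discreteTopology_map_mk' (V.grp (i + 1)) Γ
      set π := QuotientGroup.mk' (V.grp (i + 1)) with hπ
      have h := (V.toProper.map π).map_add_of_cubes (D := 2 ^ k) (A := (V.grp i).map π)
        (Γ := Γ.map π) (g := fun x => π (g x)) ?_ ?_ ?_ ?_ ?_ ?_ ?_ ?_ x y
      · simp only [← map_mul] at h
        exact QuotientGroup.eq.1 h.symm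
      · change (V.grp (Nat.log 2 1)).map π = ⊤
        rw [Nat.log_one_right, V.grp_zero]
        exact Subgroup.map_top_of_surjective _ (QuotientGroup.mk'_surjective _)
      · change (V.grp (Nat.log 2 (2 ^ k))).map π = ⊥
        rw [Nat.log_pow (by norm_num), V.grp_last, Subgroup.map_bot]
      · rintro _ ⟨a, ha, rfl⟩
        rw [Subgroup.mem_center_iff]
        intro q
        obtain ⟨f, rfl⟩ := QuotientGroup.mk'_surjective _ q
        rw [← map_mul, ← map_mul]
        refine (QuotientGroup.eq.2 ?_).symm
        have := V.commutator_mem (inv_mem ha) f⁻¹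
        convert this using 1
        rw [commutatorElement_def]; group
      · intro d
        change (V.grp i).map π ≤ (V.grp (Nat.log 2 d)).map π ∨ (V.grp (Nat.log 2 d)).map π = ⊥
        rcases Nat.lt_or_ge i (Nat.log 2 d) with h | h
        · right
          rw [Subgroup.map_eq_bot_iff, QuotientGroup.ker_mk']
          exact V.antitone h
        · left
          exact Subgroup.map_mono (V.antitone h)
      · exact continuous_quotient_mk'.comp hg
      · intro x y
        rw [← map_mul, ← map_inv, ← map_mul]
        exact Subgroup.mem_map_of_mem _ (ih (by omega) x y)
      · intro x
        simp only [hper, map_mul]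
      · intro n x t
        obtain ⟨b, hb, h⟩ := hcube n x t
        refine ⟨_, V.comp_mem_cubes π hb, fun v => ?_⟩
        rw [← map_inv, ← map_mul]
        exact Subgroup.mem_map_of_mem _ (h v)
  have := key k le_rfl x y
  rw [V.grp_last, Subgroup.mem_bot] at this
  exact (inv_mul_eq_one.1 this).symm

theorem existsUnique_oneParameterSubgroup (V : GroupFiltration F k)
    (hclosed : ∀ i, IsClosed (V.grp i : Set F)) (Γ : Subgroup F) [DiscreteTopology Γ]
    (hΓ : CocompactIn Γ V) {φ : UnitAddCircle → F ⧸ Γ} (hφ : φ ∈ circleMorphisms V Γ) :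
    ∃! f : OneParameterSubgroup F, f (Multiplicative.ofAdd 1) ∈ Γ ∧ IsInducedBy φ f := by
  obtain ⟨hc, hmor, h0⟩ := hφ
  have hcov :=
    (Γ.isQuotientCoveringMap (SetLike.isDiscrete_iff_discreteTopology.2 inferInstance)).isCoveringMap
  obtain ⟨g, ⟨hg0, hg⟩, -⟩ := hcov.existsUnique_continuousMap_lifts
    (⟨fun x : ℝ => φ x, hc.comp (AddCircle.continuous_mk' 1)⟩ : C(ℝ, F ⧸ Γ)) 0 (1 : F)
    (by simp [h0])
  have hg' : ∀ x : ℝ, (QuotientGroup.mk (g x) : F ⧸ Γ) = φ x := fun x => congrFun hg x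
  have hmem : ∀ x : ℝ, (g x)⁻¹ * g (x + 1) ∈ Γ := by
    intro x
    refine QuotientGroup.eq.1 ?_
    rw [hg', hg', AddCircle.coe_add, AddCircle.coe_period, add_zero]
  -- The element g(x)⁻¹g(x + 1) of Γ varies continuously with x, so it equals its value g(1) at x =
  -- 0.
  have hper : ∀ x, g (x + 1) = g x * g 1 := by
    intro x
    have hcont : Continuous fun x : ℝ => (⟨_, hmem x⟩ : Γ) :=
      Continuous.subtype_mk (by fun_prop) _
    have := congrArg Subtype.val
      (PreconnectedSpace.constant inferInstance hcont (x := x) (y := 0))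
    simp only [hg0, inv_one, one_mul, zero_add] at this
    rw [← this, mul_inv_cancel_left]
  have hadd := map_add_of_cubeGroup V hclosed Γ hΓ g.continuous hper (fun n x t => by
    obtain ⟨b, hb, h⟩ := hmor n _ (coe_mem_abelianCubes n x t)
    exact ⟨b, hb, fun v => QuotientGroup.eq.1 ((congrFun h v).symm.trans (hg' _).symm)⟩)
  have hind : IsInducedBy φ (OneParameterSubgroup.mk' g g.continuous hadd) := fun x => (hg' x).symm
  refine ⟨OneParameterSubgroup.mk' g g.continuous hadd, ⟨?_, hind⟩,
    fun f hf => OneParameterSubgroup.eq_of_isInducedBy hf.2 hind⟩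
  have := hmem 0
  rwa [hg0, inv_one, one_mul, zero_add] at this

end Circle

theorem existsUnique_circleMorphism {F : Type*} [Group F] [TopologicalSpace F] {k : ℕ}
    (V : GroupFiltration F k) (Γ : Subgroup F)
    (f : OneParameterSubgroup F) (hf : f (Multiplicative.ofAdd 1) ∈ Γ) :
    ∃! φ : UnitAddCircle → F ⧸ Γ, φ ∈ circleMorphisms V Γ ∧ IsInducedBy φ f := by
  have hper : Function.Periodic
      (fun x : ℝ => (QuotientGroup.mk (f (Multiplicative.ofAdd x)) : F ⧸ Γ)) 1 := by
    intro x
    refine (QuotientGroup.eq.2 ?_).symm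
    rwa [f.map_add, inv_mul_cancel_left]
  have hind : IsInducedBy hper.lift f := fun x => hper.lift_coe x
  refine ⟨hper.lift, ⟨⟨?_, ?_, ?_⟩, hind⟩, ?_⟩
  · exact continuous_coinduced_dom.2 (continuous_quotient_mk'.comp f.continuous_ofAdd)
  · rintro n c ⟨a, L, hc⟩
    obtain ⟨x, rfl⟩ := QuotientAddGroup.mk_surjective a
    -- Real lifts of the base point and of the images of the basis vectors turn the cube of ℝ/ℤ into
    -- the projection of a real affine cube.
    choose t ht using fun i : Fin n => QuotientAddGroup.mk_surjective (L (Pi.single i 1))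
    refine ⟨_, map_sum_mem_cubeGroup V f.map_add x t Finset.univ, ?_⟩
    funext v
    refine Eq.trans ?_ (hind _)
    change hper.lift (c v) = hper.lift ((x + ∑ i, ((v i : ℕ) : ℝ) * t i : ℝ) : UnitAddCircle)
    rw [hc, AddCircle.coe_add, ← Finset.univ_sum_single (fun i => ((v i : ℕ) : ℤ)), map_sum]
    refine congrArg (fun y => hper.lift ((x : UnitAddCircle) + y)) ?_
    refine Eq.trans ?_ (map_sum (QuotientAddGroup.mk' (AddSubgroup.zmultiples (1 : ℝ))) _ _).symm
    refine Finset.sum_congr rfl fun i _ => ?_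
    have he : v i = 0 ∨ v i = 1 := by generalize v i = e; revert e; decide
    rcases he with he | he
    · simp [he]
    · simpa [he] using (ht i).symm
  · have := hind 0
    simpa using this
  · rintro ψ ⟨-, hψ⟩
    funext q
    obtain ⟨x, rfl⟩ := QuotientAddGroup.mk_surjective q
    exact (hψ x).trans (hind x).symm

/-! ### The local exponential map -/

/-- Local coordinates `ψ` of a group near the identity, in which the multiplication is given by a
map `mul` that is Lipschitz in its second argument, and with a contracting square root `root`. -/
structure LocalCoordinates (E F : Type*) [NormedAddCommGroup E] [Group F] [TopologicalSpace F] where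
  ψ : E → F
  mul : E → E → E
  root : E → E
  radius : ℝ
  lip : ℝ
  radius_pos : 0 < radius
  lip_nonneg : 0 ≤ lip
  ψ_zero : ψ 0 = 1
  continuousOn_ψ : ContinuousOn ψ (Metric.ball 0 radius)
  ψ_mul : ∀ {x y}, ‖x‖ < radius → ‖y‖ < radius → ψ (mul x y) = ψ x * ψ y
  norm_mul_sub_le : ∀ {x y}, ‖x‖ < radius → ‖y‖ < radius → ‖mul x y - x‖ ≤ lip * ‖y‖
  continuousOn_mul : ContinuousOn (fun p : E × E => mul p.1 p.2)
    (Metric.ball 0 radius ×ˢ Metric.ball 0 radius)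
  norm_root_le : ∀ {x}, ‖x‖ < radius → ‖root x‖ ≤ 2 / 3 * ‖x‖
  ψ_root : ∀ {x}, ‖x‖ < radius → ψ (root x) * ψ (root x) = ψ x
  continuousOn_root : ContinuousOn root (Metric.ball 0 radius)

namespace LocalCoordinates

variable {E F : Type*} [NormedAddCommGroup E] [Group F] [TopologicalSpace F]
  (L : LocalCoordinates E F)

theorem norm_iterate_root_le {x : E} (hx : ‖x‖ < L.radius) (n : ℕ) :
    ‖L.root^[n] x‖ ≤ (2 / 3) ^ n * ‖x‖ := by
  induction n with
  | zero => simp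
  | succ n ih =>
    have h1 : (2 / 3 : ℝ) ^ n ≤ 1 := pow_le_one₀ (by norm_num) (by norm_num)
    have h2 : ‖L.root^[n] x‖ < L.radius :=
      lt_of_le_of_lt (ih.trans (mul_le_of_le_one_left (norm_nonneg x) h1)) hx
    rw [Function.iterate_succ_apply', pow_succ]
    have := L.norm_root_le h2
    linarith

theorem norm_iterate_root_lt {x : E} (hx : ‖x‖ < L.radius) (n : ℕ) :
    ‖L.root^[n] x‖ < L.radius :=
  lt_of_le_of_lt ((L.norm_iterate_root_le hx n).trans (mul_le_of_le_one_left (norm_nonneg x)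
    (pow_le_one₀ (by norm_num) (by norm_num)))) hx

theorem ψ_iterate_root {x : E} (hx : ‖x‖ < L.radius) (n : ℕ) :
    L.ψ (L.root^[n + 1] x) * L.ψ (L.root^[n + 1] x) = L.ψ (L.root^[n] x) := by
  rw [Function.iterate_succ_apply']
  exact L.ψ_root (L.norm_iterate_root_lt hx n)

/-- The contribution of the `n`-th binary digit of `t` to the one-parameter subgroup through `x`. -/
noncomputable def digit (x : E) (t : ℝ) (n : ℕ) : E :=
  if ⌊(2 : ℝ) ^ (n + 1) * t⌋ = 2 * ⌊(2 : ℝ) ^ n * t⌋ then 0 else L.root^[n + 1] x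

/-- The approximations, in coordinates, of the one-parameter subgroup through `x`, modulo integral
powers of `x`. -/
noncomputable def approx (x : E) (t : ℝ) : ℕ → E
  | 0 => 0
  | n + 1 => L.mul (approx x t n) (L.digit x t n)

theorem floor_two_mul (s : ℝ) : ⌊2 * s⌋ = 2 * ⌊s⌋ ∨ ⌊2 * s⌋ = 2 * ⌊s⌋ + 1 := by
  have h1 : 2 * ⌊s⌋ ≤ ⌊2 * s⌋ := by
    rw [Int.le_floor]; push_cast; linarith [Int.floor_le s]
  have h2 : ⌊2 * s⌋ < 2 * ⌊s⌋ + 2 := by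
    rw [Int.floor_lt]; push_cast; linarith [Int.lt_floor_add_one s]
  omega

theorem floor_two_pow (t : ℝ) (n : ℕ) : ⌊(2 : ℝ) ^ (n + 1) * t⌋ = 2 * ⌊(2 : ℝ) ^ n * t⌋ ∨
    ⌊(2 : ℝ) ^ (n + 1) * t⌋ = 2 * ⌊(2 : ℝ) ^ n * t⌋ + 1 := by
  have := floor_two_mul ((2 : ℝ) ^ n * t)
  rwa [← mul_assoc, ← pow_succ'] at this

variable {L} in
theorem norm_lt_radius {x : E} (hx : (2 * L.lip + 1) * ‖x‖ < L.radius) : ‖x‖ < L.radius := by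
  nlinarith [mul_nonneg L.lip_nonneg (norm_nonneg x)]

theorem norm_digit_le {x : E} (hx : (2 * L.lip + 1) * ‖x‖ < L.radius) (t : ℝ) (n : ℕ) :
    ‖L.digit x t n‖ ≤ (2 / 3) ^ (n + 1) * ‖x‖ := by
  unfold digit
  split_ifs
  · rw [norm_zero]; positivity
  · exact L.norm_iterate_root_le (norm_lt_radius hx) _

theorem norm_digit_lt {x : E} (hx : (2 * L.lip + 1) * ‖x‖ < L.radius) (t : ℝ) (n : ℕ) :
    ‖L.digit x t n‖ < L.radius := by
  unfold digit
  split_ifs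
  · rw [norm_zero]; exact L.radius_pos
  · exact L.norm_iterate_root_lt (norm_lt_radius hx) _

/-- The j-th digit moves the approximation by at most lip · (2/3)^(j+1) · ‖x‖, and these sum to less
than 2 · lip · ‖x‖ when lip · ‖x‖ is nonzero. The bound on (2 · lip + 1)‖x‖ therefore keeps both x
and all approximations inside the chart. -/
theorem norm_approx_le {x : E} (hx : (2 * L.lip + 1) * ‖x‖ < L.radius) (t : ℝ) (n : ℕ) :
    ‖L.approx x t n‖ ≤ 2 * L.lip * ‖x‖ * (1 - (2 / 3) ^ n) := by
  induction n with
  | zero => simp [approx]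
  | succ n ih =>
    have h0 : 0 ≤ L.lip * ‖x‖ := mul_nonneg L.lip_nonneg (norm_nonneg x)
    have hq : (0 : ℝ) ≤ (2 / 3) ^ n := by positivity
    have hlt : ‖L.approx x t n‖ < L.radius := by
      nlinarith [mul_nonneg h0 hq, norm_nonneg x]
    have h1 := L.norm_mul_sub_le hlt (L.norm_digit_lt hx t n)
    have h2 := mul_le_mul_of_nonneg_left (L.norm_digit_le hx t n) L.lip_nonneg
    have h3 := norm_sub_norm_le (L.approx x t (n + 1)) (L.approx x t n)
    rw [← approx] at h1
    rw [pow_succ] at h2 ⊢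
    nlinarith

theorem norm_approx_lt {x : E} (hx : (2 * L.lip + 1) * ‖x‖ < L.radius) (t : ℝ) (n : ℕ) :
    ‖L.approx x t n‖ < L.radius := by
  have h0 : 0 ≤ L.lip * ‖x‖ := mul_nonneg L.lip_nonneg (norm_nonneg x)
  have hq : (0 : ℝ) ≤ (2 / 3) ^ n := by positivity
  have := L.norm_approx_le hx t n
  nlinarith [mul_nonneg h0 hq, norm_nonneg x]

theorem dist_approx_le {x : E} (hx : (2 * L.lip + 1) * ‖x‖ < L.radius) (t : ℝ) (n : ℕ) :
    dist (L.approx x t n) (L.approx x t (n + 1)) ≤ 2 / 3 * L.lip * ‖x‖ * (2 / 3) ^ n := by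
  have h1 := L.norm_mul_sub_le (L.norm_approx_lt hx t n) (L.norm_digit_lt hx t n)
  have h2 := mul_le_mul_of_nonneg_left (L.norm_digit_le hx t n) L.lip_nonneg
  rw [← approx] at h1
  rw [dist_comm, dist_eq_norm]
  refine (h1.trans h2).trans (le_of_eq ?_)
  rw [pow_succ]; ring

theorem tendsto_ψ_iterate_root {x : E} (hx : ‖x‖ < L.radius) :
    Filter.Tendsto (fun n : ℕ => L.ψ (L.root^[n] x)) Filter.atTop (𝓝 1) := by
  have h : ContinuousAt L.ψ 0 := L.continuousOn_ψ.continuousAt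
    (Metric.isOpen_ball.mem_nhds (by simpa using L.radius_pos))
  rw [← L.ψ_zero]
  refine h.tendsto.comp (squeeze_zero_norm (L.norm_iterate_root_le hx) ?_)
  have := (tendsto_pow_atTop_nhds_zero_of_lt_one (by norm_num : (0 : ℝ) ≤ 2 / 3)
    (by norm_num)).mul_const ‖x‖
  rwa [zero_mul] at this

theorem continuousOn_iterate_root (n : ℕ) :
    ContinuousOn (L.root^[n]) (Metric.ball 0 L.radius) := by
  induction n with
  | zero => exact continuousOn_id
  | succ n ih =>
    rw [Function.iterate_succ']
    exact L.continuousOn_root.comp ih fun x hx => by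
      simpa using L.norm_iterate_root_lt (by simpa using hx) n

theorem continuousOn_approx (t : ℝ) (n : ℕ) :
    ContinuousOn (fun x => L.approx x t n) {x | (2 * L.lip + 1) * ‖x‖ < L.radius} := by
  induction n with
  | zero => exact continuousOn_const
  | succ n ih =>
    have hd : ContinuousOn (fun x => L.digit x t n) {x | (2 * L.lip + 1) * ‖x‖ < L.radius} := by
      unfold digit
      split_ifs
      · exact continuousOn_const
      · exact (L.continuousOn_iterate_root _).mono fun x hx => by
          simpa using norm_lt_radius hx
    exact L.continuousOn_mul.comp (f := fun x => (L.approx x t n, L.digit x t n)) (ih.prodMk hd)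
      fun x hx => ⟨by simpa using L.norm_approx_lt hx t n, by simpa using L.norm_digit_lt hx t n⟩

theorem approx_eq_zero {x : E} {t : ℝ} {n : ℕ} (ht : 0 ≤ t) (ht' : (2 : ℝ) ^ n * t < 1)
    (h0 : L.mul 0 0 = 0) : L.approx x t n = 0 := by
  induction n with
  | zero => rfl
  | succ n ih =>
    have h1 : ⌊(2 : ℝ) ^ (n + 1) * t⌋ = 0 :=
      Int.floor_eq_zero_iff.2 ⟨by positivity, ht'⟩
    have h2 : (2 : ℝ) ^ n * t < 1 := by
      refine lt_of_le_of_lt ?_ ht'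
      exact mul_le_mul_of_nonneg_right (pow_le_pow_right₀ (by norm_num) (Nat.le_succ n)) ht
    have h3 : ⌊(2 : ℝ) ^ n * t⌋ = 0 := Int.floor_eq_zero_iff.2 ⟨by positivity, h2⟩
    rw [approx, ih h2, digit, if_pos (by rw [h1, h3, mul_zero]), h0]

/-- The limit of the approximations. -/
noncomputable def log (x : E) (t : ℝ) : E := Filter.limUnder Filter.atTop (L.approx x t)

/-- A power of the n-th root is the doubled power of the next root, and the next binary digit
supplies the possibly missing factor. This identifies the convergent approximations with powers of
dyadic roots. -/
theorem ψ_approx {x : E} (hx : (2 * L.lip + 1) * ‖x‖ < L.radius) (t : ℝ) (n : ℕ) :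
    L.ψ x ^ ⌊t⌋ * L.ψ (L.approx x t n) = L.ψ (L.root^[n] x) ^ ⌊(2 : ℝ) ^ n * t⌋ := by
  induction n with
  | zero => simp [approx, L.ψ_zero]
  | succ n ih =>
    rw [approx, L.ψ_mul (L.norm_approx_lt hx t n) (L.norm_digit_lt hx t n), ← mul_assoc, ih,
      ← L.ψ_iterate_root (norm_lt_radius hx) n, ← zpow_two, ← zpow_mul]
    rcases floor_two_pow t n with h | h
    · rw [digit, if_pos h, h, L.ψ_zero, mul_one]
    · rw [digit, if_neg (by omega), h, zpow_add_one]

/-- The local one-parameter subgroup through `ψ x`. -/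
noncomputable def exp (x : E) (t : ℝ) : F := L.ψ x ^ ⌊t⌋ * L.ψ (L.log x t)

section Complete

variable [CompleteSpace E]

theorem tendsto_approx {x : E} (hx : (2 * L.lip + 1) * ‖x‖ < L.radius) (t : ℝ) :
    Filter.Tendsto (L.approx x t) Filter.atTop (𝓝 (L.log x t)) :=
  (cauchySeq_of_le_geometric _ _ (by norm_num) (L.dist_approx_le hx t)).tendsto_limUnder

theorem dist_approx_log_le {x : E} (hx : (2 * L.lip + 1) * ‖x‖ < L.radius) (t : ℝ) (n : ℕ) :
    dist (L.approx x t n) (L.log x t) ≤ 2 * L.lip * ‖x‖ * (2 / 3) ^ n := by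
  refine (dist_le_of_le_geometric_of_tendsto _ _ (by norm_num) (L.dist_approx_le hx t)
    (L.tendsto_approx hx t) n).trans (le_of_eq ?_)
  ring

theorem norm_log_lt {x : E} (hx : (2 * L.lip + 1) * ‖x‖ < L.radius) (t : ℝ) :
    ‖L.log x t‖ < L.radius := by
  have := L.dist_approx_log_le hx t 0
  rw [approx, dist_zero_left, pow_zero, mul_one] at this
  nlinarith [norm_nonneg x]

variable [IsTopologicalGroup F]

theorem tendsto_zpow_exp {x : E} (hx : (2 * L.lip + 1) * ‖x‖ < L.radius) (t : ℝ) :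
    Filter.Tendsto (fun n : ℕ => L.ψ (L.root^[n] x) ^ ⌊(2 : ℝ) ^ n * t⌋) Filter.atTop
      (𝓝 (L.exp x t)) := by
  have h : ContinuousAt L.ψ (L.log x t) := L.continuousOn_ψ.continuousAt
    (Metric.isOpen_ball.mem_nhds (by simpa using L.norm_log_lt hx t))
  have := (h.tendsto.comp (L.tendsto_approx hx t)).const_mul (L.ψ x ^ ⌊t⌋)
  exact this.congr fun n => L.ψ_approx hx t n

theorem continuousOn_exp_left (t : ℝ) :
    ContinuousOn (fun x => L.exp x t) {x | (2 * L.lip + 1) * ‖x‖ < L.radius} := by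
  have hlog : ContinuousOn (fun x => L.log x t) {x | (2 * L.lip + 1) * ‖x‖ < L.radius} := by
    refine TendstoUniformlyOn.continuousOn (F := fun n x => L.approx x t n) (p := Filter.atTop) ?_
      (Filter.Frequently.of_forall fun n => L.continuousOn_approx t n)
    rw [Metric.tendstoUniformlyOn_iff]
    intro ε hε
    have h1 := (tendsto_pow_atTop_nhds_zero_of_lt_one (by norm_num : (0 : ℝ) ≤ 2 / 3)
      (by norm_num)).const_mul L.radius
    rw [mul_zero] at h1
    filter_upwards [h1.eventually_lt_const hε] with n hn x hx
    rw [dist_comm]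
    refine lt_of_le_of_lt ((L.dist_approx_log_le hx t n).trans ?_) hn
    refine mul_le_mul_of_nonneg_right ?_ (by positivity)
    have : (2 * L.lip + 1) * ‖x‖ < L.radius := hx
    nlinarith [norm_nonneg x]
  refine ContinuousOn.mul (ContinuousOn.zpow ?_ _) (L.continuousOn_ψ.comp hlog fun x hx => ?_)
  · exact L.continuousOn_ψ.mono fun x hx => by simpa using norm_lt_radius hx
  · simpa using L.norm_log_lt hx t

variable [T2Space F]

/-- The floor of a sum exceeds the sum of the floors by 0 or 1, and the extra factor, a 2ⁿ-th root
of ψ x, tends to 1. -/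
theorem exp_add {x : E} (hx : (2 * L.lip + 1) * ‖x‖ < L.radius) (s t : ℝ) :
    L.exp x (s + t) = L.exp x s * L.exp x t := by
  have h1 := L.tendsto_ψ_iterate_root (norm_lt_radius hx)
  have h2 : Filter.Tendsto (fun n : ℕ => if ⌊(2 : ℝ) ^ n * (s + t)⌋ =
      ⌊(2 : ℝ) ^ n * s⌋ + ⌊(2 : ℝ) ^ n * t⌋ then 1 else L.ψ (L.root^[n] x)) Filter.atTop (𝓝 1) :=
    Filter.Tendsto.if' tendsto_const_nhds h1
  have h3 := ((L.tendsto_zpow_exp hx s).mul (L.tendsto_zpow_exp hx t)).mul h2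
  rw [mul_one] at h3
  refine tendsto_nhds_unique (L.tendsto_zpow_exp hx (s + t)) (h3.congr fun n => ?_)
  have h4 := Int.le_floor_add ((2 : ℝ) ^ n * s) ((2 : ℝ) ^ n * t)
  have h5 := Int.le_floor_add_floor ((2 : ℝ) ^ n * s) ((2 : ℝ) ^ n * t)
  rw [← mul_add] at h4 h5
  rw [← zpow_add]
  split_ifs with h
  · rw [mul_one, h]
  · rw [show ⌊(2 : ℝ) ^ n * (s + t)⌋ = ⌊(2 : ℝ) ^ n * s⌋ + ⌊(2 : ℝ) ^ n * t⌋ + 1 by omega,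
      zpow_add_one]

theorem exp_one {x : E} (hx : (2 * L.lip + 1) * ‖x‖ < L.radius) : L.exp x 1 = L.ψ x := by
  refine tendsto_nhds_unique (L.tendsto_zpow_exp hx 1) (tendsto_const_nhds.congr fun n => ?_)
  induction n with
  | zero => simp
  | succ n ih =>
    rw [ih, ← L.ψ_iterate_root (norm_lt_radius hx) n, ← zpow_two, ← zpow_mul]
    congr 1
    rw [mul_one, mul_one, show (2 : ℝ) ^ n = ((2 ^ n : ℤ) : ℝ) by push_cast; rfl,
      show (2 : ℝ) ^ (n + 1) = ((2 ^ (n + 1) : ℤ) : ℝ) by push_cast; rfl, Int.floor_intCast,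
      Int.floor_intCast, pow_succ']

theorem exp_zero_left (t : ℝ) : L.exp 0 t = 1 := by
  have h0 : (2 * L.lip + 1) * ‖(0 : E)‖ < L.radius := by simpa using L.radius_pos
  refine tendsto_nhds_unique (L.tendsto_zpow_exp h0 t) (tendsto_const_nhds.congr fun n => ?_)
  have := L.norm_iterate_root_le (norm_lt_radius h0) n
  rw [norm_zero, mul_zero, norm_le_zero_iff] at this
  rw [this, L.ψ_zero, one_zpow]

theorem eventually_exp_mem {O : Set F} (hO : O ∈ 𝓝 1) : ∃ δ > 0, ∀ x : E,
    (2 * L.lip + 1) * ‖x‖ < L.radius → ∀ t : ℝ, |t| < δ → L.exp x t ∈ O := by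
  have h0 : L.mul 0 0 = 0 := by
    have := L.norm_mul_sub_le (x := 0) (y := 0) (by simpa using L.radius_pos)
      (by simpa using L.radius_pos)
    simpa using this
  -- For 0 ≤ t < 2⁻ᴶ the first J binary digits vanish, so the tail estimate is uniform in x.
  -- Negative t follow by inversion.
  have hO' : O ∩ O⁻¹ ∈ 𝓝 (1 : F) := Filter.inter_mem hO (inv_mem_nhds_one F hO)
  have hψ : ContinuousAt L.ψ 0 := L.continuousOn_ψ.continuousAt
    (Metric.isOpen_ball.mem_nhds (by simpa using L.radius_pos))
  obtain ⟨η, hη, hηO⟩ := Metric.mem_nhds_iff.1 (hψ.preimage_mem_nhds (L.ψ_zero ▸ hO'))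
  have h1 := (tendsto_pow_atTop_nhds_zero_of_lt_one (by norm_num : (0 : ℝ) ≤ 2 / 3)
    (by norm_num)).const_mul L.radius
  rw [mul_zero] at h1
  obtain ⟨J, hJ⟩ := (h1.eventually_lt_const hη).exists
  have key : ∀ x : E, (2 * L.lip + 1) * ‖x‖ < L.radius → ∀ t : ℝ, 0 ≤ t → t < (1 / 2) ^ J →
      L.exp x t ∈ O ∩ O⁻¹ := by
    intro x hx t ht ht'
    have ht2 : (2 : ℝ) ^ J * t < 1 := by
      have := mul_lt_mul_of_pos_left ht' (by positivity : (0 : ℝ) < 2 ^ J)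
      rwa [← mul_pow, show (2 : ℝ) * (1 / 2) = 1 by norm_num, one_pow] at this
    have ht1 : t < 1 := lt_of_lt_of_le ht' (pow_le_one₀ (by norm_num) (by norm_num))
    rw [exp, Int.floor_eq_zero_iff.2 ⟨ht, ht1⟩, zpow_zero, one_mul]
    apply hηO
    have := L.dist_approx_log_le hx t J
    rw [L.approx_eq_zero ht ht2 h0, dist_zero_left] at this
    rw [mem_ball_zero_iff]
    refine lt_of_le_of_lt (this.trans ?_) hJ
    refine mul_le_mul_of_nonneg_right ?_ (by positivity)
    nlinarith [norm_nonneg x]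
  refine ⟨(1 / 2) ^ J, by positivity, fun x hx t ht => ?_⟩
  rcases le_total 0 t with h | h
  · rw [abs_of_nonneg h] at ht
    exact (key x hx t h ht).1
  · rw [abs_of_nonpos h] at ht
    have := (key x hx (-t) (by linarith) ht).2
    rwa [map_neg_of_map_add (L.exp_add hx), Set.mem_inv, inv_inv] at this

/-- Write exp(x, t) = exp(x, t₀) exp(x, t − t₀): the first factor is continuous in x, the second
tends to 1 uniformly in x. -/
theorem continuousOn_exp : ContinuousOn (fun p : E × ℝ => L.exp p.1 p.2)
    ({x | (2 * L.lip + 1) * ‖x‖ < L.radius} ×ˢ Set.univ) := by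
  rintro ⟨x₀, t₀⟩ ⟨hx₀, -⟩
  have h1 : Filter.Tendsto (fun p : E × ℝ => L.exp p.1 t₀)
      (𝓝[{x | (2 * L.lip + 1) * ‖x‖ < L.radius} ×ˢ Set.univ] (x₀, t₀)) (𝓝 (L.exp x₀ t₀)) :=
    ((L.continuousOn_exp_left t₀).comp continuousOn_fst fun p hp => hp.1) (x₀, t₀)
      ⟨hx₀, Set.mem_univ _⟩
  have h2 : Filter.Tendsto (fun p : E × ℝ => L.exp p.1 (p.2 - t₀))
      (𝓝[{x | (2 * L.lip + 1) * ‖x‖ < L.radius} ×ˢ Set.univ] (x₀, t₀)) (𝓝 1) := by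
    rw [Filter.tendsto_def]
    intro O hO
    obtain ⟨δ, hδ, h⟩ := L.eventually_exp_mem hO
    have hc : ContinuousAt (fun p : E × ℝ => |p.2 - t₀|) (x₀, t₀) := by fun_prop
    have hev : ∀ᶠ p : E × ℝ in 𝓝 (x₀, t₀), |p.2 - t₀| < δ :=
      hc.eventually_lt_const (by simpa using hδ)
    filter_upwards [mem_nhdsWithin_of_mem_nhds hev, self_mem_nhdsWithin] with p hp hp'
    exact h p.1 hp'.1 _ hp
  have h3 := h1.mul h2
  rw [mul_one] at h3
  refine h3.congr' ?_
  refine Filter.eventually_of_mem self_mem_nhdsWithin fun p hp => ?_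
  simp only
  rw [← L.exp_add hp.1, add_sub_cancel]

end Complete

end LocalCoordinates

/-! ### Charts of a Lie group: multiplication, squaring and square roots -/

section LieGroup

variable {E : Type*} [NormedAddCommGroup E] [NormedSpace ℝ E]
    {F : Type*} [TopologicalSpace F] [ChartedSpace E F] [Group F]

/-- The multiplication of a Lie group in the chart at the identity, centred at the origin. -/
noncomputable def chartMul (F : Type*) [TopologicalSpace F] [ChartedSpace E F] [Group F]
    (p : E × E) : E :=
  extChartAt 𝓘(ℝ, E) (1 : F) ((extChartAt 𝓘(ℝ, E) (1 : F)).symm (p.1 + extChartAt 𝓘(ℝ, E) (1 : F) 1)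
    * (extChartAt 𝓘(ℝ, E) (1 : F)).symm (p.2 + extChartAt 𝓘(ℝ, E) (1 : F) 1)) -
    extChartAt 𝓘(ℝ, E) (1 : F) 1

theorem chartMul_zero_right {x : E}
    (hx : x + extChartAt 𝓘(ℝ, E) (1 : F) 1 ∈ (extChartAt 𝓘(ℝ, E) (1 : F)).target) :
    chartMul F (x, 0) = x := by
  rw [chartMul, zero_add, extChartAt_to_inv, mul_one, PartialEquiv.right_inv _ hx,
    add_sub_cancel_right]

theorem chartMul_zero_left {x : E}
    (hx : x + extChartAt 𝓘(ℝ, E) (1 : F) 1 ∈ (extChartAt 𝓘(ℝ, E) (1 : F)).target) :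
    chartMul F (0, x) = x := by
  rw [chartMul, zero_add, extChartAt_to_inv, one_mul, PartialEquiv.right_inv _ hx,
    add_sub_cancel_right]

theorem eventually_add_mem_target : ∀ᶠ x : E in 𝓝 0,
    x + extChartAt 𝓘(ℝ, E) (1 : F) 1 ∈ (extChartAt 𝓘(ℝ, E) (1 : F)).target := by
  have hc : ContinuousAt (fun x : E => x + extChartAt 𝓘(ℝ, E) (1 : F) 1) 0 := by fun_prop
  refine hc.eventually_mem ?_
  rw [zero_add]
  exact extChartAt_target_mem_nhds (I := 𝓘(ℝ, E)) (1 : F)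

variable [LieGroup 𝓘(ℝ, E) ∞ F]

theorem contDiffAt_chartMul : ContDiffAt ℝ 1 (chartMul F : E × E → E) (0, 0) := by
  have hs : ContMDiffAt 𝓘(ℝ, E) 𝓘(ℝ, E) ∞ (fun x : E => (extChartAt 𝓘(ℝ, E) (1 : F)).symm
      (x + extChartAt 𝓘(ℝ, E) (1 : F) 1)) 0 := by
    have h1 : ContMDiffAt 𝓘(ℝ, E) 𝓘(ℝ, E) ∞ (extChartAt 𝓘(ℝ, E) (1 : F)).symm
        ((0 : E) + extChartAt 𝓘(ℝ, E) (1 : F) 1) := by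
      rw [zero_add]
      exact (contMDiffOn_extChartAt_symm (1 : F)).contMDiffAt (extChartAt_target_mem_nhds (1 : F))
    refine h1.comp (0 : E) (g := (extChartAt 𝓘(ℝ, E) (1 : F)).symm) ?_
    exact (contDiff_id.add contDiff_const).contMDiff.contMDiffAt
  have h1 : ContMDiffAt 𝓘(ℝ, E × E) 𝓘(ℝ, E) ∞ (fun p : E × E =>
      (extChartAt 𝓘(ℝ, E) (1 : F)).symm (p.1 + extChartAt 𝓘(ℝ, E) (1 : F) 1)) (0, 0) :=
    ContMDiffAt.comp (0, 0) (g := fun x : E => (extChartAt 𝓘(ℝ, E) (1 : F)).symm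
      (x + extChartAt 𝓘(ℝ, E) (1 : F) 1)) hs contDiff_fst.contMDiff.contMDiffAt
  have h2 : ContMDiffAt 𝓘(ℝ, E × E) 𝓘(ℝ, E) ∞ (fun p : E × E =>
      (extChartAt 𝓘(ℝ, E) (1 : F)).symm (p.2 + extChartAt 𝓘(ℝ, E) (1 : F) 1)) (0, 0) :=
    ContMDiffAt.comp (0, 0) (g := fun x : E => (extChartAt 𝓘(ℝ, E) (1 : F)).symm
      (x + extChartAt 𝓘(ℝ, E) (1 : F) 1)) hs contDiff_snd.contMDiff.contMDiffAt
  have h3 := h1.mul h2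
  have h4 : ContMDiffAt 𝓘(ℝ, E) 𝓘(ℝ, E) ∞ (extChartAt 𝓘(ℝ, E) (1 : F))
      ((extChartAt 𝓘(ℝ, E) (1 : F)).symm ((0 : E) + extChartAt 𝓘(ℝ, E) (1 : F) 1) *
        (extChartAt 𝓘(ℝ, E) (1 : F)).symm ((0 : E) + extChartAt 𝓘(ℝ, E) (1 : F) 1)) := by
    rw [zero_add, extChartAt_to_inv, mul_one]
    exact contMDiffAt_extChartAt
  have h5 := ContMDiffAt.comp ((0, 0) : E × E) h4 h3
  have h6 : ContDiffAt ℝ ∞ (chartMul F : E × E → E) (0, 0) :=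
    (contMDiffAt_iff_contDiffAt.1 h5).sub contDiffAt_const
  exact h6.of_le (by norm_cast)

/-- Multiplication by the identity on either side is trivial, so the derivative of the
multiplication at the origin is addition; on the diagonal this is doubling. -/
theorem hasStrictFDerivAt_chartMul_self :
    HasStrictFDerivAt (fun x : E => chartMul F (x, x))
      ((2 : ℝ) • ContinuousLinearMap.id ℝ E) 0 := by
  obtain ⟨D, hD⟩ : ∃ D : E × E →L[ℝ] E, HasStrictFDerivAt (chartMul F : E × E → E) D (0, 0) :=
    ⟨_, (contDiffAt_chartMul (F := F)).hasStrictFDerivAt (by simp)⟩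
  have h1 : D.comp (ContinuousLinearMap.inl ℝ E E) = ContinuousLinearMap.id ℝ E := by
    have h : HasFDerivAt (fun x : E => chartMul F (x, 0))
        (D.comp (ContinuousLinearMap.inl ℝ E E)) 0 :=
      HasFDerivAt.comp (0 : E) (g := (chartMul F : E × E → E))
        (f := ContinuousLinearMap.inl ℝ E E) hD.hasFDerivAt
        (ContinuousLinearMap.inl ℝ E E).hasFDerivAt
    refine h.unique ((hasFDerivAt_id (0 : E)).congr_of_eventuallyEq ?_)
    filter_upwards [eventually_add_mem_target (F := F)] with x hx
    exact chartMul_zero_right hx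
  have h2 : D.comp (ContinuousLinearMap.inr ℝ E E) = ContinuousLinearMap.id ℝ E := by
    have h : HasFDerivAt (fun x : E => chartMul F (0, x))
        (D.comp (ContinuousLinearMap.inr ℝ E E)) 0 :=
      HasFDerivAt.comp (0 : E) (g := (chartMul F : E × E → E))
        (f := ContinuousLinearMap.inr ℝ E E) hD.hasFDerivAt
        (ContinuousLinearMap.inr ℝ E E).hasFDerivAt
    refine h.unique ((hasFDerivAt_id (0 : E)).congr_of_eventuallyEq ?_)
    filter_upwards [eventually_add_mem_target (F := F)] with x hx
    exact chartMul_zero_left hx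
  have h3 : HasStrictFDerivAt (fun x : E => chartMul F (x, x))
      (D.comp ((ContinuousLinearMap.id ℝ E).prod (ContinuousLinearMap.id ℝ E))) 0 :=
    HasStrictFDerivAt.comp (0 : E) (g := (chartMul F : E × E → E)) (f := fun x : E => (x, x)) hD
      ((hasStrictFDerivAt_id (0 : E)).prodMk (hasStrictFDerivAt_id (0 : E)))
  convert h3 using 1
  ext x
  have e1 := congrArg (fun f => f x) h1
  have e2 := congrArg (fun f => f x) h2
  simp only [ContinuousLinearMap.comp_apply, ContinuousLinearMap.inl_apply,
    ContinuousLinearMap.inr_apply, ContinuousLinearMap.id_apply] at e1 e2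
  have e3 : ((x, x) : E × E) = (x, 0) + (0, x) := by simp
  simp only [ContinuousLinearMap.comp_apply, ContinuousLinearMap.prod_apply,
    ContinuousLinearMap.id_apply, smul_apply]
  rw [e3, D.map_add, e1, e2, two_smul]

/-- Near the origin, squaring in the chart of a Lie group is close to multiplication by `2`. -/
theorem eventually_norm_chartMul_self_sub_le : ∀ᶠ p : E × E in 𝓝 (0, 0),
    ‖chartMul F (p.1, p.1) - chartMul F (p.2, p.2) - (2 : ℝ) • (p.1 - p.2)‖ ≤
      1 / 2 * ‖p.1 - p.2‖ := by
  have h := (hasStrictFDerivAt_chartMul_self (E := E) (F := F)).isLittleO.def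
    (by norm_num : (0 : ℝ) < 1 / 2)
  simpa using h

/-- Equal squares give 2‖x − y‖ ≤ ½‖x − y‖ in the chart. -/
theorem exists_nhds_injOn_sq (E : Type*) [NormedAddCommGroup E] [NormedSpace ℝ E]
    (F : Type*) [TopologicalSpace F] [ChartedSpace E F] [Group F]
    [LieGroup 𝓘(ℝ, E) ∞ F] :
    ∃ U ∈ 𝓝 (1 : F), ∀ x ∈ U, ∀ y ∈ U, x * x = y * y → x = y := by
  have h := eventually_norm_chartMul_self_sub_le (E := E) (F := F)
  rw [nhds_prod_eq] at h
  obtain ⟨S, hS, h'⟩ := Filter.mem_prod_same_iff.1 h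
  replace h := fun (x : E) (hx : x ∈ S) (y : E) (hy : y ∈ S) => h' (Set.mk_mem_prod hx hy)
  simp only [Set.mem_ofPred_eq] at h
  have hc : ContinuousAt (fun g : F => extChartAt 𝓘(ℝ, E) (1 : F) g -
      extChartAt 𝓘(ℝ, E) (1 : F) 1) 1 := (continuousAt_extChartAt (1 : F)).sub continuousAt_const
  refine ⟨_, Filter.inter_mem (extChartAt_source_mem_nhds (I := 𝓘(ℝ, E)) (1 : F))
    (hc.preimage_mem_nhds (by rwa [sub_self])), fun x hx y hy hxy => ?_⟩
  have h1 := h _ hx.2 _ hy.2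
  simp only [chartMul, sub_add_cancel] at h1
  rw [PartialEquiv.left_inv _ hx.1, PartialEquiv.left_inv _ hy.1, hxy, sub_self, zero_sub, norm_neg,
    norm_smul, sub_sub_sub_cancel_right] at h1
  have h2 : ‖extChartAt 𝓘(ℝ, E) (1 : F) x - extChartAt 𝓘(ℝ, E) (1 : F) y‖ = 0 := by
    rw [Real.norm_two] at h1
    linarith [norm_nonneg (extChartAt 𝓘(ℝ, E) (1 : F) x - extChartAt 𝓘(ℝ, E) (1 : F) y)]
  exact (extChartAt 𝓘(ℝ, E) (1 : F)).injOn hx.1 hy.1 (sub_eq_zero.1 (norm_eq_zero.1 h2))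

/-- The inverse function theorem inverts squaring. Comparison with the origin gives ‖2 root x − x‖ ≤
½‖root x‖, whence the contraction constant 2/3. -/
theorem exists_chart_root [CompleteSpace E] : ∃ (root : E → E) (r : ℝ), 0 < r ∧
    ContinuousOn root (Metric.ball 0 r) ∧ ∀ x, ‖x‖ < r →
      ‖root x‖ ≤ 2 / 3 * ‖x‖ ∧ chartMul F (root x, root x) = x := by
  let e : E ≃L[ℝ] E := ContinuousLinearEquiv.smulLeft (Units.mk0 (2 : ℝ) two_ne_zero)
  have hs : HasStrictFDerivAt (fun x : E => chartMul F (x, x)) (e : E →L[ℝ] E) 0 :=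
    hasStrictFDerivAt_chartMul_self
  have h0 : chartMul F ((0 : E), (0 : E)) = 0 :=
    chartMul_zero_right (eventually_add_mem_target (F := F)).self_of_nhds
  set H := hs.toOpenPartialHomeomorph _ with hH
  have hmem : (0 : E) ∈ H.source := hs.mem_toOpenPartialHomeomorph_source
  have hcoe : ∀ x, H x = chartMul F (x, x) := fun x => rfl
  have ht : (0 : E) ∈ H.target := by
    have := H.map_source hmem
    rwa [hcoe, h0] at this
  have hsymm0 : H.symm 0 = 0 := by
    have := H.left_inv hmem
    rwa [hcoe, h0] at this
  have h := eventually_norm_chartMul_self_sub_le (E := E) (F := F)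
  rw [nhds_prod_eq] at h
  obtain ⟨S, hS, h'⟩ := Filter.mem_prod_same_iff.1 h
  replace h := fun (x : E) (hx : x ∈ S) (y : E) (hy : y ∈ S) => h' (Set.mk_mem_prod hx hy)
  simp only [Set.mem_ofPred_eq] at h
  have hc : ContinuousAt H.symm 0 := H.continuousAt_symm ht
  obtain ⟨r, hr, hrS⟩ := Metric.mem_nhds_iff.1 (Filter.inter_mem (H.open_target.mem_nhds ht)
    (hc.preimage_mem_nhds (by rwa [hsymm0])))
  refine ⟨H.symm, r, hr, H.continuousOn_symm.mono fun x hx => (hrS hx).1, fun x hx => ?_⟩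
  have hx' := hrS (mem_ball_zero_iff.2 hx)
  have e1 : chartMul F (H.symm x, H.symm x) = x := H.right_inv hx'.1
  refine ⟨?_, e1⟩
  have h1 := h _ hx'.2 _ (mem_of_mem_nhds hS)
  simp only [e1, h0, sub_zero] at h1
  have h2 := norm_sub_norm_le ((2 : ℝ) • H.symm x) x
  rw [norm_sub_rev, norm_smul] at h2
  norm_num at h2 h1
  linarith

theorem exists_localCoordinates [CompleteSpace E] : ∃ L : LocalCoordinates E F,
    L.ψ = fun x => (extChartAt 𝓘(ℝ, E) (1 : F)).symm (x + extChartAt 𝓘(ℝ, E) (1 : F) 1) := by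
  have := topologicalGroup_of_lieGroup 𝓘(ℝ, E) ∞ (G := F)
  set c := extChartAt 𝓘(ℝ, E) (1 : F) 1 with hc
  set ψ : E → F := fun x => (extChartAt 𝓘(ℝ, E) (1 : F)).symm (x + c) with hψ
  obtain ⟨root, r₀, hr₀, hroot, hroot'⟩ := exists_chart_root (E := E) (F := F)
  obtain ⟨K, S, hS, hlip⟩ := (contDiffAt_chartMul (E := E) (F := F)).exists_lipschitzOnWith
  have hψat : ∀ᶠ x in 𝓝 (0 : E), ContinuousAt ψ x := by
    filter_upwards [eventually_add_mem_target (F := F)] with x hx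
    exact ContinuousAt.comp (g := (extChartAt 𝓘(ℝ, E) (1 : F)).symm) (f := fun x => x + c)
      (continuousAt_extChartAt_symm'' hx) (by fun_prop)
  have hψ0 : ψ 0 = 1 := by simp only [hψ, zero_add, hc]; exact extChartAt_to_inv (1 : F)
  have hψc : ContinuousAt ψ 0 := hψat.self_of_nhds
  have hmul : ∀ᶠ p : E × E in 𝓝 (0, 0), ψ p.1 * ψ p.2 ∈ (extChartAt 𝓘(ℝ, E) (1 : F)).source := by
    have hcont : ContinuousAt (fun p : E × E => ψ p.1 * ψ p.2) (0, 0) :=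
      (ContinuousAt.comp (g := ψ) (f := Prod.fst) (x := ((0, 0) : E × E)) hψc continuousAt_fst).mul
        (ContinuousAt.comp (g := ψ) (f := Prod.snd) (x := ((0, 0) : E × E)) hψc continuousAt_snd)
    refine hcont.eventually_mem ?_
    simp only [hψ0, mul_one]
    exact extChartAt_source_mem_nhds (1 : F)
  have hS' : ∀ᶠ p : E × E in 𝓝 (0, 0), p ∈ S := hS
  have hall := hmul.and hS'
  rw [nhds_prod_eq] at hall
  obtain ⟨T, hT, h'⟩ := Filter.mem_prod_same_iff.1 hall
  replace hall := fun (x : E) (hx : x ∈ T) (y : E) (hy : y ∈ T) => h' (Set.mk_mem_prod hx hy)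
  simp only [Set.mem_ofPred_eq] at hall
  obtain ⟨r, hr, hrT⟩ := Metric.mem_nhds_iff.1 (Filter.inter_mem (Filter.inter_mem hT
    (Metric.ball_mem_nhds 0 hr₀)) ((eventually_add_mem_target (F := F)).and hψat))
  have hball : ∀ {x : E}, ‖x‖ < r → x ∈ Metric.ball 0 r := fun h => mem_ball_zero_iff.2 h
  have hmul' : ∀ {x y : E}, ‖x‖ < r → ‖y‖ < r → ψ (chartMul F (x, y)) = ψ x * ψ y := by
    intro x y hx hy
    have := (hall x (hrT (hball hx)).1.1 y (hrT (hball hy)).1.1).1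
    simp only [hψ, chartMul, ← hc, sub_add_cancel]
    exact PartialEquiv.left_inv _ this
  have hlip' : LipschitzOnWith K (chartMul F) (Metric.ball (0 : E) r ×ˢ Metric.ball (0 : E) r) :=
    hlip.mono fun p hp => (hall p.1 (hrT hp.1).1.1 p.2 (hrT hp.2).1.1).2
  refine ⟨{ ψ := ψ, mul := fun x y => chartMul F (x, y), root := root, radius := r, lip := K,
            radius_pos := hr, lip_nonneg := K.2, ψ_zero := hψ0,
            continuousOn_ψ := fun x hx => (hrT hx).2.2.continuousWithinAt,
            ψ_mul := hmul', norm_mul_sub_le := ?_, continuousOn_mul := hlip'.continuousOn,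
            norm_root_le := ?_, ψ_root := ?_, continuousOn_root := ?_ }, rfl⟩
  · intro x y hx hy
    have h1 := hlip'.dist_le_mul (x, y) ⟨hball hx, hball hy⟩ (x, 0)
      ⟨hball hx, hball (by simpa using hr)⟩
    rw [chartMul_zero_right (hrT (hball hx)).2.1, dist_eq_norm] at h1
    simpa [Prod.dist_eq] using h1
  · intro x hx
    exact (hroot' x (by simpa using (hrT (hball hx)).1.2)).1
  · intro x hx
    obtain ⟨h1, h2⟩ := hroot' x (by simpa using (hrT (hball hx)).1.2)
    have h3 : ‖root x‖ < r := by linarith [norm_nonneg x]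
    rw [← hmul' h3 h3, h2]
  · exact hroot.mono fun x hx => (hrT hx).1.2

/-- The local exponential map of a Lie group. -/
theorem exists_local_exp (E : Type*) [NormedAddCommGroup E] [NormedSpace ℝ E] [CompleteSpace E]
    (F : Type*) [TopologicalSpace F] [T2Space F] [ChartedSpace E F] [Group F]
    [LieGroup 𝓘(ℝ, E) ∞ F] :
    ∃ (U : Set F) (e : F → ℝ → F), U ∈ 𝓝 1 ∧
    ContinuousOn (fun p : F × ℝ => e p.1 p.2) (U ×ˢ Set.univ) ∧
    (∀ x ∈ U, ∀ s t, e x (s + t) = e x s * e x t) ∧ (∀ x ∈ U, e x 1 = x) ∧ ∀ t, e 1 t = 1 := by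
  have := topologicalGroup_of_lieGroup 𝓘(ℝ, E) ∞ (G := F)
  obtain ⟨L, hL⟩ := exists_localCoordinates (E := E) (F := F)
  set φ : F → E := fun g => extChartAt 𝓘(ℝ, E) (1 : F) g - extChartAt 𝓘(ℝ, E) (1 : F) 1 with hφ
  have hφ1 : φ 1 = 0 := sub_self _
  have hc : ContinuousOn φ (extChartAt 𝓘(ℝ, E) (1 : F)).source :=
    (continuousOn_extChartAt (1 : F)).sub continuousOn_const
  have hc1 : ContinuousAt φ 1 := (continuousAt_extChartAt (1 : F)).sub continuousAt_const
  have hlt : ∀ᶠ x : E in 𝓝 0, (2 * L.lip + 1) * ‖x‖ < L.radius := by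
    have : ContinuousAt (fun x : E => (2 * L.lip + 1) * ‖x‖) 0 := by fun_prop
    exact this.eventually_lt_const (by simpa using L.radius_pos)
  refine ⟨(extChartAt 𝓘(ℝ, E) (1 : F)).source ∩ φ ⁻¹' {x | (2 * L.lip + 1) * ‖x‖ < L.radius},
    fun g => L.exp (φ g), Filter.inter_mem (extChartAt_source_mem_nhds (1 : F))
    (hc1.preimage_mem_nhds (by rw [hφ1]; exact hlt)), ?_, ?_, ?_, ?_⟩
  · refine L.continuousOn_exp.comp (f := fun p : F × ℝ => (φ p.1, p.2)) ?_ ?_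
    · exact ContinuousOn.prodMk (hc.comp continuousOn_fst fun p hp => hp.1.1) continuousOn_snd
    · exact fun p hp => ⟨hp.1.2, Set.mem_univ _⟩
  · exact fun x hx => L.exp_add hx.2
  · intro x hx
    simp only
    rw [L.exp_one hx.2, hL]
    simp only [hφ, sub_add_cancel]
    exact PartialEquiv.left_inv _ hx.1
  · intro t
    simp only
    rw [hφ1, L.exp_zero_left]

end LieGroup

/-! ### One-parameter subgroups of simply connected nilpotent groups -/

section Nilpotent

theorem Subgroup.eq_top_of_mem_nhds_one {F : Type*} [Group F] [TopologicalSpace F]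
    [IsTopologicalGroup F] [ConnectedSpace F] (H : Subgroup F) (hH : (H : Set F) ∈ 𝓝 1) :
    H = ⊤ := by
  have ho : IsOpen (H : Set F) := H.isOpen_of_mem_nhds hH
  have := IsClopen.eq_univ ⟨H.isClosed_of_isOpen ho, ho⟩ ⟨1, H.one_mem⟩
  exact SetLike.coe_injective (by simpa using this)

/-- Modulo the i-th term u is central, so it commutes with a. -/
theorem inv_mul_mul_pow_mem_upperCentralSeries {F : Type*} [Group F] {i : ℕ} {a u : F}
    (hu : u ∈ Subgroup.upperCentralSeries F (i + 1)) (N : ℕ) :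
    (a ^ N * u ^ N)⁻¹ * (a * u) ^ N ∈ Subgroup.upperCentralSeries F i := by
  rw [← QuotientGroup.eq]
  have hc : Commute (a : F ⧸ Subgroup.upperCentralSeries F i)
      (u : F ⧸ Subgroup.upperCentralSeries F i) := by
    have h := Subgroup.mem_upperCentralSeries_succ_iff.1 (inv_mem hu) a⁻¹
    refine (QuotientGroup.eq (s := Subgroup.upperCentralSeries F i)).2 ?_
    rw [commutatorElement_def] at h
    convert h using 1
    group
  have := hc.mul_pow N
  simp only [QuotientGroup.mk_mul, QuotientGroup.mk_pow]
  exact this.symm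

variable {F : Type*} [Group F] [TopologicalSpace F] [IsTopologicalGroup F]

/-- Near the identity, the terms of the upper central series are closed under square roots,
provided that square roots are unique near the identity. -/
theorem exists_nhds_mem_upperCentralSeries_of_sq_mem_succ [ConnectedSpace F]
    (hsq : ∃ U ∈ 𝓝 (1 : F), ∀ x ∈ U, ∀ y ∈ U, x * x = y * y → x = y) (j : ℕ) :
    ∃ U ∈ 𝓝 (1 : F), ∀ v ∈ U, v ∈ Subgroup.upperCentralSeries F (j + 1) →
      v * v ∈ Subgroup.upperCentralSeries F j → v ∈ Subgroup.upperCentralSeries F j := by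
  induction j with
  | zero =>
    obtain ⟨U, hU, h⟩ := hsq
    refine ⟨U, hU, fun v hv _ hvv => ?_⟩
    rw [Subgroup.upperCentralSeries_zero, Subgroup.mem_bot] at hvv ⊢
    exact h v hv 1 (mem_of_mem_nhds hU) (by rw [hvv, mul_one])
  | succ j ih =>
    obtain ⟨U, hU, h⟩ := ih
    have hc : ∀ᶠ p : F × F in 𝓝 (1, 1), ⁅p.1, p.2⁆ ∈ U := by
      have : Continuous fun p : F × F => ⁅p.1, p.2⁆ := by
        simp only [commutatorElement_def]; fun_prop
      exact this.continuousAt.eventually_mem (by simpa using hU)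
    rw [nhds_prod_eq, Filter.eventually_prod_iff] at hc
    obtain ⟨pa, hpa, pb, hpb, hc⟩ := hc
    refine ⟨{v | pa v}, hpa, fun v hv hv2 hvv => ?_⟩
    let H : Subgroup F :=
      { carrier := {g | ⁅v, g⁆ ∈ Subgroup.upperCentralSeries F j}
        one_mem' := by simp [one_mem]
        mul_mem' := by
          intro a b ha hb
          have := mul_mem ha (Subgroup.Normal.conj_mem inferInstance _ hb a)
          simp only [Set.mem_ofPred_eq, commutatorElement_def] at this ⊢
          convert this using 1
          group
        inv_mem' := by
          intro a ha
          have := Subgroup.Normal.conj_mem inferInstance _ (inv_mem ha) a⁻¹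
          simp only [Set.mem_ofPred_eq, commutatorElement_def] at this ⊢
          convert this using 1
          group }
    have hH : H = ⊤ := by
      -- For g near 1 the commutator w = [v,g] is small, and w² = [w,v][v²,g] lies one term lower,
      -- so the induction hypothesis applies to w. The elements g with [v,g] in that term form a
      -- subgroup, and F is connected.
      refine H.eq_top_of_mem_nhds_one (Filter.mem_of_superset hpb fun g hg => ?_)
      have hw := Subgroup.mem_upperCentralSeries_succ_iff.1 hv2 g
      refine h _ (hc hv hg) hw ?_
      have h1 := Subgroup.mem_upperCentralSeries_succ_iff.1 hvv g
      have h2 := Subgroup.mem_upperCentralSeries_succ_iff.1 hw v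
      convert mul_mem h2 h1 using 1
      simp only [commutatorElement_def]
      group
    rw [Subgroup.mem_upperCentralSeries_succ_iff]
    intro g
    exact (hH ▸ Subgroup.mem_top g : g ∈ H)

theorem exists_nhds_mem_upperCentralSeries_of_sq_mem [ConnectedSpace F]
    (hsq : ∃ U ∈ 𝓝 (1 : F), ∀ x ∈ U, ∀ y ∈ U, x * x = y * y → x = y) {k : ℕ}
    (hk : Subgroup.upperCentralSeries F k = ⊤) :
    ∃ U ∈ 𝓝 (1 : F), ∀ v ∈ U, ∀ j, v * v ∈ Subgroup.upperCentralSeries F j → v ∈ Subgroup.upperCentralSeries F j := by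
  choose U hU h using exists_nhds_mem_upperCentralSeries_of_sq_mem_succ (F := F) hsq
  have hmono := Subgroup.upperCentralSeries_mono F
  refine ⟨⋂ j ∈ Finset.range k, U j, (Filter.biInter_finset_mem _).2 fun j _ => hU j, ?_⟩
  intro v hv j hvv
  simp only [Set.mem_iInter, Finset.mem_range] at hv
  have key : ∀ d, v ∈ Subgroup.upperCentralSeries F (j + d) →
      v ∈ Subgroup.upperCentralSeries F j := by
    intro d
    induction d with
    | zero => exact id
    | succ d ih =>
      intro hd
      refine ih ?_
      rcases Nat.lt_or_ge (j + d) k with hlt | hge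
      · exact h _ v (hv _ hlt) hd (hmono (Nat.le_add_right j d) hvv)
      · exact hmono hge (hk ▸ Subgroup.mem_top v)
  exact key k (hmono (Nat.le_add_left k j) (hk ▸ Subgroup.mem_top v))

theorem mem_of_pow_two_pow_mem {G : Type*} [Group G] {Z : Subgroup G} {U : Set G}
    (h : ∀ v ∈ U, v * v ∈ Z → v ∈ Z) {v : G} {m : ℕ} (hv : v ^ 2 ^ m ∈ Z)
    (hU : ∀ l < m, v ^ 2 ^ l ∈ U) : v ∈ Z := by
  induction m with
  | zero => simpa using hv
  | succ m ih =>
    refine ih (h _ (hU m (Nat.lt_succ_self m)) ?_) fun l hl => hU l (Nat.lt_succ_of_lt hl)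
    rwa [← pow_two, ← pow_mul, ← pow_succ]

theorem pow_two_pow_of_map_add {G : Type*} [Group G] {f : ℝ → G}
    (hf : ∀ s t, f (s + t) = f s * f t) {l m : ℕ} (hl : l ≤ m) :
    f ((1 / 2) ^ m) ^ 2 ^ l = f ((1 / 2) ^ (m - l)) := by
  rw [← map_nat_mul_of_map_add hf]
  congr 1
  obtain ⟨d, rfl⟩ := Nat.exists_eq_add_of_le hl
  rw [Nat.add_sub_cancel_left, pow_add, ← mul_assoc]
  push_cast
  rw [← mul_pow]
  norm_num

/-- Two continuous families of one-parameter subgroups of a nilpotent group with the same values at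
`1` agree if they agree at one parameter. -/
theorem eq_of_apply_one_eq [T2Space F] [ConnectedSpace F]
    (hsq : ∃ U ∈ 𝓝 (1 : F), ∀ x ∈ U, ∀ y ∈ U, x * x = y * y → x = y) {k : ℕ}
    (hk : Subgroup.upperCentralSeries F k = ⊤) {X : Type*} [TopologicalSpace X]
    [PreconnectedSpace X]
    {α β : X → ℝ → F} (hα : Continuous fun p : X × ℝ => α p.1 p.2)
    (hβ : Continuous fun p : X × ℝ => β p.1 p.2)
    (α_add : ∀ x s t, α x (s + t) = α x s * α x t) (β_add : ∀ x s t, β x (s + t) = β x s * β x t)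
    (h1 : ∀ x, α x 1 = β x 1) {x₀ : X} (hx₀ : α x₀ = β x₀) (x : X) : α x = β x := by
  have hα' : ∀ t, Continuous fun x => α x t := fun t =>
    hα.comp (by fun_prop : Continuous fun x => (x, t))
  have hβ' : ∀ t, Continuous fun x => β x t := fun t =>
    hβ.comp (by fun_prop : Continuous fun x => (x, t))
  have hclosed : IsClosed {x | α x = β x} := by
    have : {x | α x = β x} = ⋂ t, {x | α x t = β x t} := by
      ext x; simp [funext_iff]
    rw [this]
    exact isClosed_iInter fun t => isClosed_eq (hα' t) (hβ' t)
  -- Near a parameter of agreement, write α(2⁻ᵐ) = a and β(2⁻ᵐ) = au with m fixed and u near 1. As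
  -- (au)^(2ᵐ) = a^(2ᵐ), u in one term of the upper central series puts u^(2ᵐ) in the preceding one,
  -- and repeated square roots near 1 put u there too. Descending gives u = 1; smaller dyadic times
  -- follow from uniqueness of small square roots.
  have hopen : IsOpen {x | α x = β x} := by
    rw [isOpen_iff_mem_nhds]
    intro y hy
    obtain ⟨O, hO, hOsq⟩ := hsq
    obtain ⟨O', hO', hOZ⟩ := exists_nhds_mem_upperCentralSeries_of_sq_mem ⟨O, hO, hOsq⟩ hk
    have hev : ∀ᶠ p : X × ℝ in 𝓝 (y, 0), α p.1 p.2 ∈ O ∧ β p.1 p.2 ∈ O := by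
      refine (hα.continuousAt.eventually_mem ?_).and (hβ.continuousAt.eventually_mem ?_)
      · simpa [map_zero_of_map_add (α_add y)] using hO
      · simpa [map_zero_of_map_add (β_add y)] using hO
    rw [nhds_prod_eq, Filter.eventually_prod_iff] at hev
    obtain ⟨pa, hpa, pb, hpb, hev⟩ := hev
    obtain ⟨δ, hδ, hδb⟩ := Metric.eventually_nhds_iff.1 hpb
    obtain ⟨m, hm⟩ := exists_pow_lt_of_lt_one hδ (by norm_num : (1 / 2 : ℝ) < 1)
    have hsmall : ∀ x, pa x → ∀ n ≥ m, α x ((1 / 2) ^ n) ∈ O ∧ β x ((1 / 2) ^ n) ∈ O := by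
      intro x hx n hn
      refine hev hx (hδb ?_)
      rw [dist_zero_right, Real.norm_of_nonneg (by positivity)]
      exact lt_of_le_of_lt (pow_le_pow_of_le_one (by norm_num) (by norm_num) hn) hm
    have hroot : ∀ᶠ x in 𝓝 y, ∀ l ∈ Finset.range m,
        ((α x ((1 / 2) ^ m))⁻¹ * β x ((1 / 2) ^ m)) ^ 2 ^ l ∈ O' := by
      rw [Filter.eventually_all_finset]
      intro l _
      have hc : Continuous fun x => ((α x ((1 / 2) ^ m))⁻¹ * β x ((1 / 2) ^ m)) ^ 2 ^ l :=
        ((hα' _).inv.mul (hβ' _)).pow _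
      refine hc.continuousAt.eventually_mem ?_
      have hy' : α y = β y := hy
      simpa [hy'] using hO'
    filter_upwards [hpa, hroot] with x hx hxr
    set a := α x ((1 / 2) ^ m) with ha
    set u := a⁻¹ * β x ((1 / 2) ^ m) with hu
    have hau : a * u = β x ((1 / 2) ^ m) := by rw [hu, mul_inv_cancel_left]
    have hpow : (a * u) ^ 2 ^ m = a ^ 2 ^ m := by
      have e1 := pow_two_pow_of_map_add (α_add x) (le_refl m)
      have e2 := pow_two_pow_of_map_add (β_add x) (le_refl m)
      rw [Nat.sub_self, pow_zero] at e1 e2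
      rw [hau, e2, ha, e1, h1]
    have hdesc : ∀ j, u ∈ Subgroup.upperCentralSeries F j →
        u ∈ Subgroup.upperCentralSeries F 0 := by
      intro j
      induction j with
      | zero => exact id
      | succ j ih =>
        intro hj
        refine ih (mem_of_pow_two_pow_mem (U := O') (fun v hv => hOZ v hv j) (m := m) ?_
          fun l hl => hxr l (Finset.mem_range.2 hl))
        have := inv_mul_mul_pow_mem_upperCentralSeries (a := a) hj (2 ^ m)
        rw [hpow, mul_inv_rev, inv_mul_cancel_right] at this
        exact inv_mem_iff.1 this
    have hu1 := hdesc k (hk ▸ Subgroup.mem_top u)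
    rw [Subgroup.upperCentralSeries_zero, Subgroup.mem_bot] at hu1
    rw [hu1, mul_one] at hau
    refine eq_of_map_add_of_eq_dyadic (hα.comp (by fun_prop : Continuous fun t : ℝ => (x, t)))
      (hβ.comp (by fun_prop : Continuous fun t : ℝ => (x, t))) (α_add x) (β_add x) m ?_
    intro n hn
    induction n, hn using Nat.le_induction with
    | base => exact hau
    | succ n hn ih =>
      have hs := hsmall x hx (n + 1) (Nat.le_succ_of_le hn)
      refine hOsq _ hs.1 _ hs.2 ?_
      have e : (1 / 2 : ℝ) ^ (n + 1) + (1 / 2) ^ (n + 1) = (1 / 2) ^ n := by rw [pow_succ]; ring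
      rw [← α_add, ← β_add, e, ih]
  have : {x | α x = β x} = Set.univ := IsClopen.eq_univ ⟨hclosed, hopen⟩ ⟨x₀, hx₀⟩
  exact (this ▸ Set.mem_univ x : x ∈ {x | α x = β x})

/-- A local exponential map: a continuous family of one-parameter subgroups, parametrized by their
values at `1` in a neighbourhood of the identity. -/
structure LocalExp (F : Type*) [Group F] [TopologicalSpace F] where
  dom : Set F
  exp : F → ℝ → F
  dom_mem : dom ∈ 𝓝 1
  continuousOn : ContinuousOn (fun p : F × ℝ => exp p.1 p.2) (dom ×ˢ Set.univ)
  exp_add : ∀ x ∈ dom, ∀ s t, exp x (s + t) = exp x s * exp x t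
  exp_one : ∀ x ∈ dom, exp x 1 = x
  one_exp : ∀ t, exp 1 t = 1
  sq_inj : ∃ U ∈ 𝓝 (1 : F), ∀ x ∈ U, ∀ y ∈ U, x * x = y * y → x = y

namespace LocalExp

theorem continuous_comp {F : Type*} [Group F] [TopologicalSpace F] (e : LocalExp F)
    {X : Type*} [TopologicalSpace X] {a : X → F} {τ : X → ℝ}
    (ha : Continuous a) (hτ : Continuous τ) (hdom : ∀ x, a x ∈ e.dom) :
    Continuous fun x => e.exp (a x) (τ x) :=
  e.continuousOn.comp_continuous (ha.prodMk hτ) fun x => ⟨hdom x, Set.mem_univ _⟩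

/-- One-parameter subgroups are locally given by the local exponential map. -/
theorem exp_eq_of_forall_mem (e : LocalExp F) [T2Space F] [ConnectedSpace F] {k : ℕ}
    (hk : Subgroup.upperCentralSeries F k = ⊤) {f : ℝ → F} (hf : Continuous f)
    (f_add : ∀ s t, f (s + t) = f s * f t) {c : ℝ} (hdom : ∀ τ : unitInterval, f (τ * c) ∈ e.dom)
    (t : ℝ) : e.exp (f c) t = f (t * c) := by
  have h := eq_of_apply_one_eq e.sq_inj hk (X := unitInterval)
    (α := fun τ t => e.exp (f (τ * c)) t) (β := fun τ t => f (t * (τ * c)))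
    (e.continuous_comp (by fun_prop) continuous_snd fun p => hdom p.1) (by fun_prop)
    (fun τ s t => e.exp_add _ (hdom τ) s t) (fun τ s t => by rw [add_mul, f_add])
    (fun τ => by simp only [e.exp_one _ (hdom τ), one_mul])
    (x₀ := 0) (by funext t; simp [map_zero_of_map_add f_add, e.one_exp]) 1
  have := congrFun h t
  simpa using this

variable {K : Type*} [TopologicalSpace K] [CompactSpace K]

/-- Small paths in a term of the upper central series lift to paths of one-parameter subgroups,
if this holds for the preceding term. -/
theorem exists_lift_of_small (e : LocalExp F) [T2Space F] [ConnectedSpace F] {k : ℕ}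
    (hk : Subgroup.upperCentralSeries F k = ⊤) {i : ℕ}
    (ih : ∀ (f : K × unitInterval → ℝ → F) (q : K × unitInterval → F),
      (Continuous fun p : (K × unitInterval) × ℝ => f p.1 p.2) →
      (∀ x s t, f x (s + t) = f x s * f x t) → Continuous q →
      (∀ x, q x ∈ Subgroup.upperCentralSeries F i) → (∀ κ, q (κ, 0) = 1) →
      ∃ h : K × unitInterval → ℝ → F, (Continuous fun p : (K × unitInterval) × ℝ => h p.1 p.2) ∧
        (∀ x s t, h x (s + t) = h x s * h x t) ∧ (∀ x, h x 1 = f x 1 * q x) ∧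
        ∀ κ, h (κ, 0) = f (κ, 0)) :
    ∃ V ∈ 𝓝 (1 : F), ∀ (f : K × unitInterval → ℝ → F) (q : K × unitInterval → F),
      (Continuous fun p : (K × unitInterval) × ℝ => f p.1 p.2) →
      (∀ x s t, f x (s + t) = f x s * f x t) → Continuous q →
      (∀ x, q x ∈ Subgroup.upperCentralSeries F (i + 1)) → (∀ κ, q (κ, 0) = 1) → (∀ x, q x ∈ V) →
      ∃ h : K × unitInterval → ℝ → F, (Continuous fun p : (K × unitInterval) × ℝ => h p.1 p.2) ∧
        (∀ x s t, h x (s + t) = h x s * h x t) ∧ (∀ x, h x 1 = f x 1 * q x) ∧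
        ∀ κ, h (κ, 0) = f (κ, 0) := by
  obtain ⟨O, hO, hOZ⟩ := exists_nhds_mem_upperCentralSeries_of_sq_mem e.sq_inj hk
  have hV : ∀ᶠ u in 𝓝 (1 : F), ∀ t ∈ Set.Icc (0 : ℝ) 1, e.exp u t ∈ O := by
    refine isCompact_Icc.eventually_forall_of_forall_eventually fun t _ => ?_
    have hc : ContinuousAt (fun p : F × ℝ => e.exp p.1 p.2) (1, t) :=
      e.continuousOn.continuousAt (prod_mem_nhds e.dom_mem Filter.univ_mem)
    refine hc.eventually_mem ?_
    simpa [e.one_exp] using hO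
  refine ⟨_, Filter.inter_mem hV e.dom_mem, fun f q hf f_add hq hqZ hq0 hqV => ?_⟩
  have hqe : Continuous fun p : (K × unitInterval) × ℝ => e.exp (q p.1) p.2 :=
    e.continuous_comp (hq.comp continuous_fst) continuous_snd fun p => (hqV p.1).2
  have hev : ∀ᶠ t in 𝓝 (0 : ℝ), ∀ x ∈ (Set.univ : Set (K × unitInterval)),
      f x t ∈ e.dom ∧ f x t * e.exp (q x) t ∈ e.dom := by
    refine isCompact_univ.eventually_forall_of_forall_eventually fun x _ => ?_
    have hz : e.exp (q x) 0 = 1 := map_zero_of_map_add (e.exp_add _ (hqV x).2)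
    have hc1 : Continuous fun p : ℝ × (K × unitInterval) => f p.2 p.1 := hf.comp continuous_swap
    have hc2 : Continuous fun p : ℝ × (K × unitInterval) => f p.2 p.1 * e.exp (q p.2) p.1 :=
      hc1.mul (hqe.comp continuous_swap)
    refine (hc1.continuousAt.eventually_mem ?_).and (hc2.continuousAt.eventually_mem ?_)
    · simpa [map_zero_of_map_add (f_add x)] using e.dom_mem
    · simpa [map_zero_of_map_add (f_add x), hz] using e.dom_mem
  obtain ⟨δ, hδ, hδ'⟩ := Metric.eventually_nhds_iff.1 hev
  obtain ⟨m, hm⟩ := exists_pow_lt_of_lt_one hδ (by norm_num : (1 / 2 : ℝ) < 1)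
  set c : ℝ := (1 / 2) ^ m with hc
  have hcpos : 0 < c := by positivity
  have hdom : ∀ x, ∀ t : ℝ, 0 ≤ t → t ≤ c → f x t ∈ e.dom ∧ f x t * e.exp (q x) t ∈ e.dom := by
    intro x t ht htc
    refine hδ' ?_ x (Set.mem_univ x)
    rw [dist_zero_right, Real.norm_of_nonneg ht]
    exact lt_of_le_of_lt htc hm
  -- At the small time c = 2⁻ᵐ the product still lies in the domain of the local exponential. The
  -- one-parameter subgroup h through it at time c has h(1) = a^(2ᵐ), a first approximation to
  -- f(1)q.
  set a : K × unitInterval → F := fun x => f x c * e.exp (q x) c with ha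
  have had : ∀ x, a x ∈ e.dom := fun x => (hdom x c hcpos.le le_rfl).2
  have hac : Continuous a :=
    (hf.comp (by fun_prop : Continuous fun x : K × unitInterval => (x, c))).mul
      (hqe.comp (by fun_prop : Continuous fun x : K × unitInterval => (x, c)))
  set h : K × unitInterval → ℝ → F := fun x t => e.exp (a x) (2 ^ m * t) with hh
  have hhc : Continuous fun p : (K × unitInterval) × ℝ => h p.1 p.2 :=
    e.continuous_comp (hac.comp continuous_fst) (by fun_prop) fun p => had p.1
  have h_add : ∀ x s t, h x (s + t) = h x s * h x t := fun x s t => by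
    simp only [hh]; rw [mul_add, e.exp_add _ (had x)]
  have hh1 : ∀ x, h x 1 = a x ^ 2 ^ m := by
    intro x
    have := map_nat_mul_of_map_add (e.exp_add _ (had x)) (2 ^ m) 1
    rw [e.exp_one _ (had x)] at this
    rw [← this]
    simp [hh]
  have hcm : (2 : ℝ) ^ m * c = 1 := by rw [hc, ← mul_pow]; norm_num
  have hh0 : ∀ κ, h (κ, 0) = f (κ, 0) := by
    intro κ
    funext t
    have e1 : a (κ, 0) = f (κ, 0) c := by simp [ha, hq0, e.one_exp]
    simp only [hh, e1]
    rw [e.exp_eq_of_forall_mem hk (f := f (κ, 0))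
      (hf.comp (by fun_prop : Continuous fun t : ℝ => ((κ, (0 : unitInterval)), t)))
      (f_add (κ, 0)) (c := c)]
    · congr 1
      rw [mul_right_comm, hcm, one_mul]
    · intro τ
      exact (hdom _ _ (mul_nonneg τ.2.1 hcpos.le) (mul_le_of_le_one_left hcpos.le τ.2.2)).1
  -- The root exp(q, c) lies in the same term as q, so it commutes with f(c) modulo the preceding
  -- term. The remaining error is left to the induction hypothesis.
  have hz : ∀ x, (h x 1)⁻¹ * (f x 1 * q x) ∈ Subgroup.upperCentralSeries F i := by
    intro x
    have hq_add := e.exp_add _ (hqV x).2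
    have e1 : ∀ l ≤ m, e.exp (q x) c ^ 2 ^ l = e.exp (q x) ((1 / 2) ^ (m - l)) := fun l hl =>
      pow_two_pow_of_map_add hq_add hl
    have e2 : e.exp (q x) c ^ 2 ^ m = q x := by
      rw [e1 m le_rfl, Nat.sub_self, pow_zero, e.exp_one _ (hqV x).2]
    have e3 : f x c ^ 2 ^ m = f x 1 := by
      rw [pow_two_pow_of_map_add (f_add x) le_rfl, Nat.sub_self, pow_zero]
    have e4 : e.exp (q x) c ∈ Subgroup.upperCentralSeries F (i + 1) := by
      refine mem_of_pow_two_pow_mem (U := O) (fun v hv => hOZ v hv (i + 1)) (m := m)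
        (by rw [e2]; exact hqZ x) fun l hl => ?_
      rw [e1 l hl.le]
      exact (hqV x).1 _ ⟨by positivity, pow_le_one₀ (by norm_num) (by norm_num)⟩
    have := inv_mem (inv_mul_mul_pow_mem_upperCentralSeries (a := f x c) e4 (2 ^ m))
    rwa [e2, e3, mul_inv_rev, inv_inv, ← hh1] at this
  obtain ⟨h', hc', h_add', h1', h0'⟩ := ih h (fun x => (h x 1)⁻¹ * (f x 1 * q x)) hhc h_add
    (by
      have h1c : Continuous fun x => h x 1 :=
        hhc.comp (by fun_prop : Continuous fun x : K × unitInterval => (x, (1 : ℝ)))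
      have f1c : Continuous fun x => f x 1 :=
        hf.comp (by fun_prop : Continuous fun x : K × unitInterval => (x, (1 : ℝ)))
      exact h1c.inv.mul (f1c.mul hq))
    hz (fun κ => by simp only [hh0, hq0, mul_one, inv_mul_cancel])
  exact ⟨h', hc', h_add', fun x => by rw [h1', mul_inv_cancel_left],
    fun κ => by rw [h0', hh0]⟩

/-- Paths in a nilpotent group lift to paths of one-parameter subgroups. -/
theorem exists_lift (e : LocalExp F) [T2Space F] [ConnectedSpace F] {k : ℕ}
    (hk : Subgroup.upperCentralSeries F k = ⊤)
    (i : ℕ) (f : K × unitInterval → ℝ → F) (q : K × unitInterval → F)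
    (hf : Continuous fun p : (K × unitInterval) × ℝ => f p.1 p.2)
    (f_add : ∀ x s t, f x (s + t) = f x s * f x t) (hq : Continuous q)
    (hqZ : ∀ x, q x ∈ Subgroup.upperCentralSeries F i) (hq0 : ∀ κ, q (κ, 0) = 1) :
    ∃ h : K × unitInterval → ℝ → F, (Continuous fun p : (K × unitInterval) × ℝ => h p.1 p.2) ∧
      (∀ x s t, h x (s + t) = h x s * h x t) ∧ (∀ x, h x 1 = f x 1 * q x) ∧
      ∀ κ, h (κ, 0) = f (κ, 0) := by
  induction i generalizing f q with
  | zero =>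
    refine ⟨f, hf, f_add, fun x => ?_, fun _ => rfl⟩
    have := hqZ x
    rw [Subgroup.upperCentralSeries_zero, Subgroup.mem_bot] at this
    rw [this, mul_one]
  | succ i ih =>
    obtain ⟨V, hV, hsmall⟩ := e.exists_lift_of_small (K := K) hk ih
    let pr : ℝ → unitInterval := Set.projIcc 0 1 zero_le_one
    have hpr : Continuous pr := continuous_projIcc
    -- By compactness the path is cut into n pieces with small increments. Stopping it at time j/n
    -- by a minimum gives a family on the whole interval, and the lifts are built by induction on j.
    have hev : ∀ᶠ τ in 𝓝 (0 : ℝ), ∀ x ∈ (Set.univ : Set ((K × unitInterval) × unitInterval)),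
        (q (x.1.1, min x.1.2 x.2))⁻¹ * q (x.1.1, min x.1.2 (pr (x.2 + τ))) ∈ V := by
      refine isCompact_univ.eventually_forall_of_forall_eventually fun x _ => ?_
      have hc : Continuous fun p : ℝ × ((K × unitInterval) × unitInterval) =>
          (q (p.2.1.1, min p.2.1.2 p.2.2))⁻¹ * q (p.2.1.1, min p.2.1.2 (pr (p.2.2 + p.1))) := by
        fun_prop
      refine hc.continuousAt.eventually_mem ?_
      have : pr ((x.2 : ℝ) + 0) = x.2 := by rw [add_zero]; exact Set.projIcc_val _ _
      simp only [this, inv_mul_cancel]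
      exact hV
    obtain ⟨n, hn, hn0⟩ := ((tendsto_one_div_atTop_nhds_zero_nat.eventually hev).and
      (Filter.eventually_gt_atTop 0)).exists
    have hn0' : (n : ℝ) ≠ 0 := by positivity
    have key : ∀ j ≤ n, ∃ h : K × unitInterval → ℝ → F,
        (Continuous fun p : (K × unitInterval) × ℝ => h p.1 p.2) ∧
        (∀ x s t, h x (s + t) = h x s * h x t) ∧
        (∀ x, h x 1 = f x 1 * q (x.1, min x.2 (pr (j / n)))) ∧ ∀ κ, h (κ, 0) = f (κ, 0) := by
      intro j hj
      induction j with
      | zero =>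
        refine ⟨f, hf, f_add, fun x => ?_, fun _ => rfl⟩
        have : pr ((0 : ℕ) / n) = 0 := by
          rw [Nat.cast_zero, zero_div]; exact Set.projIcc_left _
        rw [this, min_eq_right (unitInterval.nonneg' : 0 ≤ x.2), hq0, mul_one]
      | succ j ihj =>
        obtain ⟨h, hc, h_add, h1, h0⟩ := ihj (by omega)
        have hval : ((pr (j / n) : unitInterval) : ℝ) = j / n := by
          have hmem : (j / n : ℝ) ∈ Set.Icc (0 : ℝ) 1 := by
            refine ⟨by positivity, (div_le_one (by positivity)).2 ?_⟩
            exact_mod_cast (by omega : j ≤ n)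
          exact congrArg Subtype.val (Set.projIcc_of_mem zero_le_one hmem)
        obtain ⟨h', hc', h_add', h1', h0'⟩ := hsmall h
          (fun x => (q (x.1, min x.2 (pr (j / n))))⁻¹ * q (x.1, min x.2 (pr ((j + 1 : ℕ) / n))))
          hc h_add (by fun_prop) (fun x => mul_mem (inv_mem (hqZ _)) (hqZ _))
          (fun κ => by
            simp only [min_eq_left (unitInterval.nonneg' : (0 : unitInterval) ≤ _), hq0, inv_one,
              mul_one])
          (fun x => by
            have := hn (x, pr (j / n)) (Set.mem_univ _)
            simp only [hval] at this
            rwa [← add_div, ← Nat.cast_succ] at this)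
        refine ⟨h', hc', h_add', fun x => ?_, fun κ => by rw [h0', h0]⟩
        rw [h1', h1]
        group
    obtain ⟨h, hc, h_add, h1, h0⟩ := key n le_rfl
    refine ⟨h, hc, h_add, fun x => ?_, h0⟩
    have : pr (n / n) = 1 := by
      rw [div_self hn0']; exact Set.projIcc_right _
    rw [h1, this, min_eq_left (unitInterval.le_one' : x.2 ≤ 1)]

/-- In a path connected nilpotent group, every element lies on a one-parameter subgroup. -/
theorem exists_oneParameter (e : LocalExp F) [T2Space F] [PathConnectedSpace F] {k : ℕ}
    (hk : Subgroup.upperCentralSeries F k = ⊤) (x : F) :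
    ∃ f : ℝ → F, Continuous f ∧ (∀ s t, f (s + t) = f s * f t) ∧ f 1 = x := by
  let γ : Path (1 : F) x := PathConnectedSpace.somePath 1 x
  obtain ⟨h, hc, h_add, h1, -⟩ := e.exists_lift (K := Unit) hk k (fun _ _ => 1) (fun p => γ p.2)
    continuous_const (by simp) (by fun_prop) (fun _ => hk ▸ Subgroup.mem_top _) (by simp)
  exact ⟨h ((), 1),
    hc.comp (by fun_prop : Continuous fun t : ℝ => (((), (1 : unitInterval)), t)), h_add _,
    by simp [h1]⟩

/-- In a simply connected nilpotent group, one-parameter subgroups are determined by their values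
at `1`. -/
theorem oneParameter_injective (e : LocalExp F) [T2Space F] [SimplyConnectedSpace F] {k : ℕ}
    (hk : Subgroup.upperCentralSeries F k = ⊤) {f f' : ℝ → F} (hf : Continuous f)
    (hf' : Continuous f')
    (f_add : ∀ s t, f (s + t) = f s * f t) (f_add' : ∀ s t, f' (s + t) = f' s * f' t)
    (h1 : f 1 = f' 1) : f = f' := by
  let p : Path (1 : F) (f 1) :=
    { toFun := fun s => f s
      continuous_toFun := by fun_prop
      source' := map_zero_of_map_add f_add
      target' := rfl }
  let p' : Path (1 : F) (f 1) :=
    { toFun := fun s => f' s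
      continuous_toFun := by fun_prop
      source' := map_zero_of_map_add f_add'
      target' := h1.symm }
  obtain ⟨H⟩ := SimplyConnectedSpace.paths_homotopic p p'
  obtain ⟨h, hc, h_add, hh1, hh0⟩ := e.exists_lift (K := unitInterval) hk k (fun _ _ => 1)
    (fun x => H x) continuous_const (by simp) (by fun_prop) (fun _ => hk ▸ Subgroup.mem_top _)
    (fun κ => by simp)
  -- The path s ↦ g(s) has the evident lift by t ↦ g(ts), and rigidity shows that it is the only one
  -- starting at the trivial subgroup.
  have hend : ∀ (κ : unitInterval) (g : ℝ → F), Continuous g → (∀ s t, g (s + t) = g s * g t) →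
      (∀ s : unitInterval, H (κ, s) = g s) → h (κ, 1) = g := by
    intro κ g hg g_add hHg
    have := eq_of_apply_one_eq e.sq_inj hk (X := unitInterval) (α := fun s => h (κ, s))
      (β := fun s t => g (t * s))
      (hc.comp (by fun_prop : Continuous fun q : unitInterval × ℝ => ((κ, q.1), q.2)))
      (by fun_prop) (fun s => h_add _) (fun s t t' => by rw [add_mul, g_add])
      (fun s => by simp [hh1, hHg]) (x₀ := 0)
      (by funext t; simp [hh0, map_zero_of_map_add g_add]) 1
    rw [this]
    funext t
    simp
  have e0 : h (0, 1) = f := hend 0 f hf f_add fun s => H.apply_zero s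
  have e1 : h (1, 1) = f' := hend 1 f' hf' f_add' fun s => H.apply_one s
  -- The homotopy fixes endpoints, so all the final one-parameter subgroups have the same value at
  -- 1; rigidity makes them equal.
  have := eq_of_apply_one_eq e.sq_inj hk (X := unitInterval) (α := fun κ => h (κ, 1))
    (β := fun _ => f)
    (hc.comp (by fun_prop : Continuous fun q : unitInterval × ℝ =>
      ((q.1, (1 : unitInterval)), q.2)))
    (by fun_prop) (fun κ => h_add _) (fun _ => f_add) (fun κ => by simp [hh1]) (x₀ := 0) e0 1
  rw [← e1, this]

end LocalExp

end Nilpotent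

/-! ### Application to Lie groups and proof of the theorem -/

theorem nonempty_localExp (E : Type*) [NormedAddCommGroup E] [NormedSpace ℝ E] [CompleteSpace E]
    (F : Type*) [TopologicalSpace F] [T2Space F] [ChartedSpace E F] [Group F]
    [LieGroup 𝓘(ℝ, E) ∞ F] : Nonempty (LocalExp F) := by
  obtain ⟨U, e, hU, hc, hadd, h1, h0⟩ := exists_local_exp E F
  exact ⟨{ dom := interior U, exp := e, dom_mem := interior_mem_nhds.2 hU,
           continuousOn := hc.mono (Set.prod_mono interior_subset subset_rfl),
           exp_add := fun x hx => hadd x (interior_subset hx),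
           exp_one := fun x hx => h1 x (interior_subset hx), one_exp := h0,
           sq_inj := exists_nhds_injOn_sq E F }⟩

theorem GroupFiltration.exists_upperCentralSeries_eq_top {F : Type*} [Group F] {k : ℕ}
    (V : GroupFiltration F k) : ∃ n, Subgroup.upperCentralSeries F n = ⊤ := by
  have h : Group.IsNilpotent F := by
    rw [Subgroup.nilpotent_iff_finite_descending_central_series]
    refine ⟨k, V.grp, ⟨V.grp_zero, fun x n hx g => ?_⟩, V.grp_last⟩
    exact V.commutator_mem' hx g
  exact h.nilpotent'

theorem bijective_apply_one {F : Type*} [Group F] [TopologicalSpace F] [IsTopologicalGroup F]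
    [T2Space F] [SimplyConnectedSpace F] (e : LocalExp F) {k : ℕ} (V : GroupFiltration F k) :
    Function.Bijective fun f : OneParameterSubgroup F => f (Multiplicative.ofAdd 1) := by
  obtain ⟨n, hn⟩ := V.exists_upperCentralSeries_eq_top
  refine ⟨fun f f' h => ?_, fun x => ?_⟩
  · have := e.oneParameter_injective hn f.continuous_ofAdd f'.continuous_ofAdd f.map_add
      f'.map_add h
    ext x
    exact congrFun this x.toAdd
  · obtain ⟨f, hf, f_add, h1⟩ := e.exists_oneParameter hn x
    exact ⟨OneParameterSubgroup.mk' f hf f_add, h1⟩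

end

theorem mainTheorem12
    {E : Type*} [NormedAddCommGroup E] [NormedSpace ℝ E] [FiniteDimensional ℝ E]
    {F : Type*} [TopologicalSpace F] [T2Space F] [ChartedSpace E F] [Group F]
    [LieGroup 𝓘(ℝ, E) ∞ F]
    {k : ℕ} (V : GroupFiltration F k) (hclosed : ∀ i, IsClosed (V.grp i : Set F))
    (Γ : Subgroup F) [DiscreteTopology Γ] (hΓ : CocompactIn Γ V) :
    (∀ φ ∈ circleMorphisms V Γ, ∃! f : OneParameterSubgroup F,
      f (Multiplicative.ofAdd 1) ∈ Γ ∧ IsInducedBy φ f) ∧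
    (∀ f : OneParameterSubgroup F, f (Multiplicative.ofAdd 1) ∈ Γ →
      ∃! φ : UnitAddCircle → F ⧸ Γ, φ ∈ circleMorphisms V Γ ∧ IsInducedBy φ f) ∧
    (SimplyConnectedSpace F →
      ∃ e : circleMorphisms V Γ ≃ Γ, ∀ φ : circleMorphisms V Γ,
        ∃ f : OneParameterSubgroup F, f (Multiplicative.ofAdd 1) = (e φ : F) ∧
          IsInducedBy φ.1 f) := by
  have := topologicalGroup_of_lieGroup 𝓘(ℝ, E) ∞ (G := F)
  have := FiniteDimensional.complete ℝ E
  have h1 := fun φ (hφ : φ ∈ circleMorphisms V Γ) =>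
    existsUnique_oneParameterSubgroup V hclosed Γ hΓ hφ
  have h2 := existsUnique_circleMorphism V Γ
  refine ⟨h1, h2, fun _ => ?_⟩
  obtain ⟨e⟩ := nonempty_localExp E F
  obtain ⟨hinj, hsurj⟩ := bijective_apply_one e V
  choose f hf _ using fun φ : circleMorphisms V Γ => h1 φ.1 φ.2
  refine ⟨Equiv.ofBijective (fun φ => ⟨_, (hf φ).1⟩) ⟨fun φ ψ h => ?_, fun γ => ?_⟩,
    fun φ => ⟨f φ, rfl, (hf φ).2⟩⟩
  · have hfe : f φ = f ψ := hinj (congrArg Subtype.val h)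
    exact Subtype.ext ((h2 (f φ) (hf φ).1).unique ⟨φ.2, (hf φ).2⟩ ⟨ψ.2, hfe ▸ (hf ψ).2⟩)
  · obtain ⟨g, hg⟩ := hsurj γ
    have hg' : g (Multiplicative.ofAdd 1) = γ := hg
    obtain ⟨φ, ⟨hφ, hφg⟩, -⟩ := h2 g (hg' ▸ γ.2)
    refine ⟨⟨φ, hφ⟩, Subtype.ext ?_⟩
    change f ⟨φ, hφ⟩ (Multiplicative.ofAdd 1) = γ
    rw [← hg', OneParameterSubgroup.eq_of_isInducedBy (hf ⟨φ, hφ⟩).2 hφg]
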